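/- All graphs are finite and simple. Let $k\ge 2$. A multiset $\mathscr P$ of paths of a graph $G$ is a \emph{$k$-rainbow separating path system} of $G$ if its elements can be coloured with $k$ colours so that for every two distinct edges $e_1,e_2$ of $G$ there are paths $P_1,P_2\in\mathscr P$ of distinct colours such that $P_1$ contains $e_1$ but not $e_2$, and $P_2$ contains $e_2$ but not $e_1$. Let $c_k(G)$ be the smallest cardinality (counted with multiplicity) of a $k$-rainbow separating path system of $G$. A \emph{spider with $q\ge 3$ legs} is a tree consisting of a centre and $q$ paths (the legs) that start at the centre and are otherwise pairwise vertex-disjoint; the length of a leg is its number of edges. \textbf{Theorem.} Let $S_{n,q}$ be a spider with $n$ vertices and $q\ge 3$ legs, each of length at least $2$. If $q=3$ or at least two legs have length exactly $2$, then \[ c_2(S_{n,q})= \begin{cases} n-1+\lfloor 2q/3\rfloor & \text{if } q=3 \text{ or } q\equiv 1\pmod 3,\\ n-2+\lfloor 2q/3\rfloor & \text{otherwise.} \end{cases} \] If $q>3$ and at most one leg has length exactly $2$, then \[ c_2(S_{n,q})= \begin{cases} n-1+\lfloor 2q/3\rfloor & \text{if } q\equiv 1\pmod 3,\\ n-2+\lfloor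 2q/3\rfloor+\varepsilon & \text{otherwise,} \end{cases} \] where $\varepsilon\in\{0,1\}$ (and may depend on the spider). -/

import Mathlib

namespace RainbowSep

/-- A subgraph `H` of `G` is a path of `G`: it consists of the vertices and edges traversed by a
walk without repeated vertices. -/
def IsPathOf {V : Type*} (G : SimpleGraph V) (H : G.Subgraph) : Prop :=
  ∃ (u v : V) (p : G.Walk u v), p.IsPath ∧ p.toSubgraph = H

/-- A multiset `P` of paths of `G` is a `k`-rainbow separating path system: its elements can be
coloured with `k` colours (`C` is the coloured multiset; repeated copies of a path may receive
different colours) so that any two distinct edges `e₁, e₂` of `G` are separated by two paths of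
distinct colours, one containing `e₁` but not `e₂`, the other containing `e₂` but not `e₁`. -/
def IsRSPS {V : Type*} (G : SimpleGraph V) (k : ℕ) (P : Multiset G.Subgraph) : Prop :=
  (∀ H ∈ P, IsPathOf G H) ∧
  ∃ C : Multiset (G.Subgraph × Fin k), C.map Prod.fst = P ∧
    ∀ e₁ ∈ G.edgeSet, ∀ e₂ ∈ G.edgeSet, e₁ ≠ e₂ →
      ∃ X ∈ C, ∃ Y ∈ C, X.2 ≠ Y.2 ∧
        (e₁ ∈ X.1.edgeSet ∧ e₂ ∉ X.1.edgeSet) ∧ (e₂ ∈ Y.1.edgeSet ∧ e₁ ∉ Y.1.edgeSet)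

/-- The `k`-rainbow separation number `c_k(G)`: the least cardinality (with multiplicity) of a
`k`-rainbow separating path system of `G`. (For finite `G` and `2 ≤ k` such a system exists, for
instance all single-edge paths, each in two colours.) -/
noncomputable def rainbowSepNumber {V : Type*} (G : SimpleGraph V) (k : ℕ) : ℕ :=
  sInf {m : ℕ | ∃ P : Multiset G.Subgraph, IsRSPS G k P ∧ Multiset.card P = m}

/-- The spider with legs of lengths `ℓ 0, …, ℓ (q - 1)`: the vertex `none` is the centre, and
`some ⟨i, j⟩` is the vertex of leg `i` at distance `j + 1` from the centre. -/
def spider {q : ℕ} (ℓ : Fin q → ℕ) : SimpleGraph (Option (Σ i : Fin q, Fin (ℓ i))) :=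
  SimpleGraph.fromRel fun x y =>
    match x, y with
    | none, some b => b.2.val = 0
    | some a, some b => a.1 = b.1 ∧ a.2.val + 1 = b.2.val
    | _, none => False

end RainbowSep

namespace RainbowSep

/-- A path of a spider with leg set `ι`, given by its two end vertices; `(i, a)` is the vertex of
leg `i` at distance `a` from the centre. -/
abbrev LegPath (ι : Type*) := (ι × ℕ) × (ι × ℕ)

/-- Whether a path contains the edge `e`, the edge of leg `e.1` joining the vertices at distances
`e.2` and `e.2 + 1` from the centre. -/
def covers {ι : Type*} [DecidableEq ι] (P : LegPath ι) (e : ι × ℕ) : Bool :=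
  xor (decide (e.1 = P.1.1 ∧ e.2 < P.1.2)) (decide (e.1 = P.2.1 ∧ e.2 < P.2.2))

/-- A family of paths with colours `c` that separates the edges of the spider with leg lengths
`ℓ`. -/
structure IsSep {ι κ : Type*} [DecidableEq ι] (ℓ : ι → ℕ) (p : κ → LegPath ι) (c : κ → Bool) :
    Prop where
  valid : ∀ x, (p x).1.2 ≤ ℓ (p x).1.1 ∧ (p x).2.2 ≤ ℓ (p x).2.1
  sep : ∀ e f : ι × ℕ, e.2 < ℓ e.1 → f.2 < ℓ f.1 → e ≠ f → ∃ x y, c x ≠ c y ∧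
    (covers (p x) e = true ∧ covers (p x) f = false) ∧
    (covers (p y) f = true ∧ covers (p y) e = false)

/-- Every edge is contained in paths of both colours. -/
def Bicoloured {ι κ : Type*} [DecidableEq ι] (ℓ : ι → ℕ) (p : κ → LegPath ι) (c : κ → Bool) :
    Prop :=
  ∀ e : ι × ℕ, e.2 < ℓ e.1 → ∀ γ, ∃ x, c x = γ ∧ covers (p x) e = true

/-- Move an end vertex from depth `n` of leg `i` to depth `n + 1`. -/
def stretchEnd {ι : Type*} [DecidableEq ι] (i : ι) (n : ℕ) (v : ι × ℕ) : ι × ℕ :=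
  if v = (i, n) then (i, n + 1) else v

/-- Prolong a path that ends at depth `n` of leg `i` by one edge. -/
def stretch {ι : Type*} [DecidableEq ι] (i : ι) (n : ℕ) (P : LegPath ι) : LegPath ι :=
  (stretchEnd i n P.1, stretchEnd i n P.2)

/-! ### Prolonging paths at the end of a leg. -/

section Stretch

variable {ι : Type*} [DecidableEq ι]

lemma stretchEnd_below_of_ne (i : ι) (n : ℕ) (v e : ι × ℕ) (he : e ≠ (i, n)) :
    (e.1 = (stretchEnd i n v).1 ∧ e.2 < (stretchEnd i n v).2) ↔ (e.1 = v.1 ∧ e.2 < v.2) := by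
  unfold stretchEnd
  split_ifs with h
  · subst h
    obtain ⟨k, d⟩ := e
    have : k = i → d ≠ n := fun h1 h2 => he (by rw [h1, h2])
    constructor
    · rintro ⟨h1, h2⟩
      have := this h1
      refine ⟨h1, ?_⟩
      simp only at h2 ⊢
      omega
    · rintro ⟨h1, h2⟩
      refine ⟨h1, ?_⟩
      simp only at h2 ⊢
      omega
  · rfl

lemma stretchEnd_below_self (i : ι) (n : ℕ) (v : ι × ℕ) (hn : 1 ≤ n) (hv : v.1 = i → v.2 ≤ n) :
    (i = (stretchEnd i n v).1 ∧ n < (stretchEnd i n v).2) ↔ (i = v.1 ∧ n - 1 < v.2) := by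
  unfold stretchEnd
  split_ifs with h
  · subst h
    simp only [true_and]
    omega
  · obtain ⟨k, d⟩ := v
    constructor
    · rintro ⟨h1, h2⟩
      simp only at h1 h2 hv
      have := hv h1.symm
      omega
    · rintro ⟨h1, h2⟩
      simp only at h1 h2 hv
      have h3 := hv h1.symm
      exact absurd (by rw [h1]; congr 1; omega) h

lemma covers_stretch_of_ne (i : ι) (n : ℕ) (P : LegPath ι) (e : ι × ℕ) (he : e ≠ (i, n)) :
    covers (stretch i n P) e = covers P e := by
  unfold covers stretch
  simp only [stretchEnd_below_of_ne i n _ e he]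

/-- As long as no end lies deeper than `n` on the leg, reaching the new edge after stretching
amounts to having reached the old last edge. -/
lemma covers_stretch_self (i : ι) (n : ℕ) (P : LegPath ι) (hn : 1 ≤ n)
    (h1 : P.1.1 = i → P.1.2 ≤ n) (h2 : P.2.1 = i → P.2.2 ≤ n) :
    covers (stretch i n P) (i, n) = covers P (i, n - 1) := by
  unfold covers stretch
  simp only [stretchEnd_below_self i n _ hn h1, stretchEnd_below_self i n _ hn h2]

lemma covers_eq_false_of_le (P : LegPath ι) (i : ι) (n : ℕ)
    (h1 : P.1.1 = i → P.1.2 ≤ n) (h2 : P.2.1 = i → P.2.2 ≤ n) :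
    covers P (i, n) = false := by
  have a1 : ¬ (i = P.1.1 ∧ n < P.1.2) := fun h => absurd (h1 h.1.symm) (by omega)
  have a2 : ¬ (i = P.2.1 ∧ n < P.2.2) := fun h => absurd (h2 h.1.symm) (by omega)
  simp [covers, a1, a2]

lemma covers_arm (i : ι) {a b : ℕ} (hab : a ≤ b) (e : ι × ℕ) :
    covers ((i, a), (i, b)) e = true ↔ e.1 = i ∧ a ≤ e.2 ∧ e.2 < b := by
  unfold covers
  by_cases h : e.1 = i
  · by_cases h1 : e.2 < a <;> by_cases h2 : e.2 < b <;> simp [h, h1, h2] <;> omega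
  · simp [h]

end Stretch

/-! ### Adding one edge to a leg. -/

section Extend

variable {ι κ : Type*} [DecidableEq ι]

/-- Lengthen leg `i` (of length `n`) by one edge: prolong the paths in `A`, and add the path that
consists of the new edge. -/
def extendFamily (p : κ → LegPath ι) (i : ι) (n : ℕ) (A : κ → Bool) : Option κ → LegPath ι
  | none => ((i, n), (i, n + 1))
  | some x => if A x then stretch i n (p x) else p x

/-- The colours of `extendFamily`; the new path has colour `γ`. -/
def extendColour (c : κ → Bool) (γ : Bool) : Option κ → Bool
  | none => γ
  | some x => c x

lemma covers_extendFamily_none (p : κ → LegPath ι) (i : ι) (n : ℕ) (A : κ → Bool) (e : ι × ℕ) :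
    covers (extendFamily p i n A none) e = true ↔ e = (i, n) := by
  rw [extendFamily, covers_arm i (Nat.le_succ n)]
  constructor
  · rintro ⟨h1, h2, h3⟩
    exact Prod.ext h1 (by simp only; omega)
  · rintro rfl
    simp

lemma covers_extendFamily_some (p : κ → LegPath ι) (i : ι) (n : ℕ) (A : κ → Bool) (e : ι × ℕ)
    (he : e ≠ (i, n)) (x : κ) :
    covers (extendFamily p i n A (some x)) e = covers (p x) e := by
  unfold extendFamily
  dsimp only
  split_ifs
  · exact covers_stretch_of_ne i n _ e he
  · rfl

lemma covers_extendFamily_some_self {ℓ : ι → ℕ} (p : κ → LegPath ι)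
    (hv : ∀ x, (p x).1.2 ≤ ℓ (p x).1.1 ∧ (p x).2.2 ≤ ℓ (p x).2.1)
    (i : ι) (hi : 1 ≤ ℓ i) (A : κ → Bool)
    (hA : ∀ x, A x = true → covers (p x) (i, ℓ i - 1) = true) (x : κ) :
    covers (extendFamily p i (ℓ i) A (some x)) (i, ℓ i) = A x := by
  have h1 : (p x).1.1 = i → (p x).1.2 ≤ ℓ i := fun h => h ▸ (hv x).1
  have h2 : (p x).2.1 = i → (p x).2.2 ≤ ℓ i := fun h => h ▸ (hv x).2
  unfold extendFamily
  by_cases h : A x = true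
  · simp only [h, if_true]
    rw [covers_stretch_self i _ _ hi h1 h2, hA x h]
  · rw [Bool.not_eq_true] at h
    simp only [h]
    rw [if_neg (by simp), covers_eq_false_of_le _ i _ h1 h2]

lemma le_update_succ (ℓ : ι → ℕ) (i j : ι) : ℓ j ≤ Function.update ℓ i (ℓ i + 1) j := by
  by_cases h : j = i
  · subst h; simp
  · simp [h]

lemma stretchEnd_le {ℓ : ι → ℕ} (i : ι) (v : ι × ℕ) (hv : v.2 ≤ ℓ v.1) :
    (stretchEnd i (ℓ i) v).2 ≤ Function.update ℓ i (ℓ i + 1) (stretchEnd i (ℓ i) v).1 := by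
  unfold stretchEnd
  split_ifs
  · simp
  · exact hv.trans (le_update_succ ℓ i _)

lemma lt_of_lt_update {ℓ : ι → ℕ} {i : ι} {e : ι × ℕ}
    (he : e.2 < Function.update ℓ i (ℓ i + 1) e.1) (hne : e ≠ (i, ℓ i)) : e.2 < ℓ e.1 := by
  obtain ⟨k, d⟩ := e
  by_cases h : k = i
  · subst h
    simp only [Function.update_self, ne_eq, Prod.mk.injEq, true_and] at he hne ⊢
    omega
  · simpa [h] using he

/-- Lengthening a leg by one edge preserves separation under a local condition. -/
lemma IsSep.extend {ℓ : ι → ℕ} {p : κ → LegPath ι} {c : κ → Bool} (hS : IsSep ℓ p c)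
    (i : ι) (hi : 1 ≤ ℓ i) (γ : Bool) (A : κ → Bool)
    (hA : ∀ x, A x = true → covers (p x) (i, ℓ i - 1) = true)
    (hg : ∀ g : ι × ℕ, g.2 < ℓ g.1 →
      (∃ x, c x ≠ γ ∧ covers (p x) g = true ∧ A x = false) ∨
      ((∃ x, c x ≠ γ ∧ A x = true ∧ covers (p x) g = false) ∧
        ∃ y, c y = γ ∧ covers (p y) g = true ∧ A y = false)) :
    IsSep (Function.update ℓ i (ℓ i + 1)) (extendFamily p i (ℓ i) A) (extendColour c γ) := by
  have key : ∀ g : ι × ℕ, g.2 < ℓ g.1 → g ≠ (i, ℓ i) → ∃ x y,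
      extendColour c γ x ≠ extendColour c γ y ∧
      (covers (extendFamily p i (ℓ i) A x) (i, ℓ i) = true ∧
        covers (extendFamily p i (ℓ i) A x) g = false) ∧
      (covers (extendFamily p i (ℓ i) A y) g = true ∧
        covers (extendFamily p i (ℓ i) A y) (i, ℓ i) = false) := by
    intro g hgl hne
    -- The new edge is represented either by the new one-edge path, of colour `γ`, or by a prolonged
    -- path of the other colour that avoids `g`. Its partner must contain `g` and not be prolonged.
    rcases hg g hgl with ⟨x, hx1, hx2, hx3⟩ | ⟨⟨x, hx1, hx2, hx3⟩, y, hy1, hy2, hy3⟩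
    · refine ⟨none, some x, ?_, ⟨?_, ?_⟩, ?_, ?_⟩
      · exact hx1.symm
      · rw [covers_extendFamily_none]
      · rw [← Bool.not_eq_true, covers_extendFamily_none]; exact hne
      · rwa [covers_extendFamily_some _ _ _ _ _ hne]
      · rw [covers_extendFamily_some_self p hS.valid i hi A hA]; exact hx3
    · refine ⟨some x, some y, ?_, ⟨?_, ?_⟩, ?_, ?_⟩
      · simpa [extendColour, hy1] using hx1
      · rw [covers_extendFamily_some_self p hS.valid i hi A hA]; exact hx2
      · rwa [covers_extendFamily_some _ _ _ _ _ hne]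
      · rwa [covers_extendFamily_some _ _ _ _ _ hne]
      · rw [covers_extendFamily_some_self p hS.valid i hi A hA]; exact hy3
  refine ⟨?_, ?_⟩
  · rintro (_ | x)
    · constructor
      · simp [extendFamily]
      · simp [extendFamily]
    · unfold extendFamily
      dsimp only
      split_ifs
      · exact ⟨stretchEnd_le i _ (hS.valid x).1, stretchEnd_le i _ (hS.valid x).2⟩
      · exact ⟨(hS.valid x).1.trans (le_update_succ ℓ i _),
          (hS.valid x).2.trans (le_update_succ ℓ i _)⟩
  · intro e f he hf hne
    by_cases he' : e = (i, ℓ i)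
    · subst he'
      exact key f (lt_of_lt_update hf hne.symm) hne.symm
    · by_cases hf' : f = (i, ℓ i)
      · subst hf'
        obtain ⟨x, y, h1, h2, h3⟩ := key e (lt_of_lt_update he hne) hne
        exact ⟨y, x, h1.symm, h3, h2⟩
      · obtain ⟨x, y, h1, h2, h3⟩ :=
          hS.sep e f (lt_of_lt_update he he') (lt_of_lt_update hf hf') hne
        refine ⟨some x, some y, h1, ?_, ?_⟩
        · rwa [covers_extendFamily_some _ _ _ _ _ he', covers_extendFamily_some _ _ _ _ _ hf']
        · rwa [covers_extendFamily_some _ _ _ _ _ he', covers_extendFamily_some _ _ _ _ _ hf']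

end Extend

/-! ### Legs that can be lengthened repeatedly. -/

section Extendable

variable {ι κ : Type*} [DecidableEq ι]

/-- A local condition at the end of leg `i` that allows the leg to be lengthened by one edge at
the cost of one path, and is inherited by the longer leg: the last edge is contained in exactly
three paths, whose colours and extents are of one of three kinds. -/
def Extendable (ℓ : ι → ℕ) (p : κ → LegPath ι) (c : κ → Bool) (i : ι) : Prop :=
  ∃ x₀ x₁ x₂, x₀ ≠ x₁ ∧ x₀ ≠ x₂ ∧ x₁ ≠ x₂ ∧ c x₀ = c x₁ ∧
    (∀ x, covers (p x) (i, ℓ i - 1) = true ↔ x = x₀ ∨ x = x₁ ∨ x = x₂) ∧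
    ((c x₂ ≠ c x₀ ∧ p x₀ = ((i, ℓ i - 1), (i, ℓ i))) ∨
      (c x₂ = c x₀ ∧ p x₀ = ((i, ℓ i - 1), (i, ℓ i))) ∨
      (c x₂ ≠ c x₀ ∧ 2 ≤ ℓ i ∧ p x₂ = ((i, ℓ i - 1), (i, ℓ i)) ∧
        p x₀ = ((i, ℓ i - 2), (i, ℓ i)) ∧ covers (p x₁) (i, ℓ i - 2) = true))

lemma Extendable.extendFamily_of_ne {ℓ : ι → ℕ} {p : κ → LegPath ι} {c : κ → Bool} {i j : ι}
    (hj : Extendable ℓ p c j) (hij : j ≠ i) (γ : Bool) (A : κ → Bool)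
    (hA : ∀ x, A x = true → covers (p x) (i, ℓ i - 1) = true) :
    Extendable (Function.update ℓ i (ℓ i + 1)) (extendFamily p i (ℓ i) A) (extendColour c γ) j := by
  obtain ⟨x₀, x₁, x₂, h01, h02, h12, hc, hx, hst⟩ := hj
  have harm : ∀ x a b, a ≤ b → p x = ((j, a), (j, b)) →
      extendFamily p i (ℓ i) A (some x) = ((j, a), (j, b)) := by
    intro x a b hab hp
    have : A x = false := by
      by_contra h
      have := hA x (by simpa using h)
      rw [hp, covers_arm _ hab] at this
      exact hij this.1.symm
    simp [extendFamily, this, hp]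
  have hcov : ∀ x d, covers (extendFamily p i (ℓ i) A (some x)) (j, d) = covers (p x) (j, d) :=
    fun x d => covers_extendFamily_some p i (ℓ i) A (j, d) (fun h => hij (congrArg Prod.fst h)) x
  refine ⟨some x₀, some x₁, some x₂, by simpa using h01, by simpa using h02, by simpa using h12,
    hc, ?_, ?_⟩
  · rw [Function.update_of_ne hij]
    rintro (_ | x)
    · rw [covers_extendFamily_none]
      simp [hij]
    · rw [hcov, hx]
      simp
  · rw [Function.update_of_ne hij]
    rcases hst with ⟨h1, h2⟩ | ⟨h1, h2⟩ | ⟨h1, h2, h3, h4, h5⟩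
    · exact Or.inl ⟨h1, harm _ _ _ (Nat.sub_le _ _) h2⟩
    · exact Or.inr (Or.inl ⟨h1, harm _ _ _ (Nat.sub_le _ _) h2⟩)
    · exact Or.inr (Or.inr ⟨h1, h2, harm _ _ _ (Nat.sub_le _ _) h3, harm _ _ _ (Nat.sub_le _ _) h4,
        by rw [hcov]; exact h5⟩)

lemma stretch_arm (i : ι) {a n : ℕ} (h : a < n) :
    stretch i n ((i, a), (i, n)) = ((i, a), (i, n + 1)) := by
  have : (i, a) ≠ (i, n) := by simp; omega
  simp [stretch, stretchEnd, h.ne]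

lemma bool_eq_of_ne_of_ne {a b γ : Bool} (h1 : a ≠ γ) (h2 : b ≠ γ) : a = b := by
  cases a <;> cases b <;> cases γ <;> simp_all

/-- An extendable leg of a separating family can be lengthened by one edge, keeping it
extendable. -/
lemma IsSep.extendable_step {ℓ : ι → ℕ} {p : κ → LegPath ι} {c : κ → Bool} (hS : IsSep ℓ p c)
    {i : ι} (hi : 2 ≤ ℓ i) (hE : Extendable ℓ p c i) :
    ∃ (γ : Bool) (A : κ → Bool), (∀ x, A x = true → covers (p x) (i, ℓ i - 1) = true) ∧
      (∃ x, A x = true ∧ c x ≠ γ) ∧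
      IsSep (Function.update ℓ i (ℓ i + 1)) (extendFamily p i (ℓ i) A) (extendColour c γ) ∧
      Extendable (Function.update ℓ i (ℓ i + 1)) (extendFamily p i (ℓ i) A)
        (extendColour c γ) i := by
  classical
  obtain ⟨x₀, x₁, x₂, h01, h02, h12, hc, hx, hst⟩ := hE
  have hcov := fun A hA => covers_extendFamily_some_self p hS.valid i (by omega : 1 ≤ ℓ i) A hA
  have hn1 : ∀ A, covers (extendFamily p i (ℓ i) A none) (i, ℓ i) = true := fun A => by
    rw [covers_extendFamily_none]
  have hleaf : ∀ y, (p y) = ((i, ℓ i - 1), (i, ℓ i)) → ∀ g : ι × ℕ, g ≠ (i, ℓ i - 1) →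
      covers (p y) g = false := by
    intro y hy g hg
    rw [← Bool.not_eq_true, hy, covers_arm _ (Nat.sub_le _ _)]
    rintro ⟨h1, h2, h3⟩
    exact hg (Prod.ext h1 (by simp only; omega))
  have hstr1 : stretch i (ℓ i) ((i, ℓ i - 1), (i, ℓ i)) = ((i, ℓ i - 1), (i, ℓ i + 1)) :=
    stretch_arm i (by omega)
  -- The first and third kinds are treated alike: prolong `x₀` and `x₂`, one of each colour, and
  -- give the new path the colour of `x₂`. The new path then plays the role of `x₀`, and the new end
  -- is of the first kind.
  have main : ∀ hne : c x₂ ≠ c x₀,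
      (∀ g : ι × ℕ, g.2 < ℓ g.1 →
      (∃ x, c x ≠ c x₂ ∧ covers (p x) g = true ∧ (decide (x = x₀ ∨ x = x₂)) = false) ∨
      ((∃ x, c x ≠ c x₂ ∧ (decide (x = x₀ ∨ x = x₂)) = true ∧ covers (p x) g = false) ∧
        ∃ y, c y = c x₂ ∧ covers (p y) g = true ∧ (decide (y = x₀ ∨ y = x₂)) = false)) →
      ∃ (γ : Bool) (A : κ → Bool), (∀ x, A x = true → covers (p x) (i, ℓ i - 1) = true) ∧
      (∃ x, A x = true ∧ c x ≠ γ) ∧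
      IsSep (Function.update ℓ i (ℓ i + 1)) (extendFamily p i (ℓ i) A) (extendColour c γ) ∧
      Extendable (Function.update ℓ i (ℓ i + 1)) (extendFamily p i (ℓ i) A)
        (extendColour c γ) i := by
    intro hne hg
    have hA : ∀ x, decide (x = x₀ ∨ x = x₂) = true → covers (p x) (i, ℓ i - 1) = true := by
      intro x hxA
      rw [hx]
      have := of_decide_eq_true hxA
      tauto
    refine ⟨c x₂, fun x => decide (x = x₀ ∨ x = x₂), hA, ⟨x₀, by simp, hne.symm⟩,
      hS.extend i (by omega) _ _ hA hg, ?_⟩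
    refine ⟨none, some x₂, some x₀, by simp, by simp, by simpa using h02.symm, rfl, ?_, ?_⟩
    · rw [Function.update_self, Nat.add_sub_cancel]
      rintro (_ | x)
      · simp [hn1]
      · rw [hcov _ hA]
        simp [or_comm]
    · rw [Function.update_self, Nat.add_sub_cancel]
      exact Or.inl ⟨hne.symm, rfl⟩
  rcases hst with ⟨h1, h2⟩ | ⟨h1, h2⟩ | ⟨h1, h2, h3, h4, h5⟩
  · refine main h1 fun g hg => ?_
    by_cases hgl : g = (i, ℓ i - 1)
    · subst hgl
      exact Or.inl ⟨x₁, hc ▸ h1.symm, by simp [hx], by simp [h01.symm, h12]⟩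
    · obtain ⟨x, y, hxy, ⟨hxl, hxg⟩, hyg, hyl⟩ :=
        hS.sep (i, ℓ i - 1) g (by simp only; omega) hg (Ne.symm hgl)
      have hy0 : y ≠ x₀ := by rintro rfl; rw [hleaf _ h2 g hgl] at hyg; cases hyg
      have hy2 : y ≠ x₂ := by
        rintro rfl; rw [(hx _).2 (by simp)] at hyl; cases hyl
      by_cases hyc : c y = c x₂
      · exact Or.inr ⟨⟨x₀, h1.symm, by simp, hleaf _ h2 g hgl⟩, y, hyc, hyg, by simp [hy0, hy2]⟩
      · exact Or.inl ⟨y, hyc, hyg, by simp [hy0, hy2]⟩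
  -- Here all three paths share a colour, so two are prolonged and the new path gets the other
  -- colour. The new end is of the third kind, so the kinds evolve as second, third, first, and then
  -- first forever.
  · have hA : ∀ x, decide (x = x₀ ∨ x = x₁) = true → covers (p x) (i, ℓ i - 1) = true := by
      intro x hxA
      rw [hx]
      have := of_decide_eq_true hxA
      tauto
    refine ⟨!c x₀, fun x => decide (x = x₀ ∨ x = x₁), hA, ⟨x₀, by simp, by simp⟩,
      hS.extend i (by omega) _ _ hA fun g hg => ?_, ?_⟩
    · by_cases hgl : g = (i, ℓ i - 1)
      · subst hgl
        exact Or.inl ⟨x₂, by simp [h1], by simp [hx], by simp [h12.symm, h02.symm]⟩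
      · obtain ⟨x, y, hxy, ⟨hxl, hxg⟩, hyg, hyl⟩ :=
          hS.sep (i, ℓ i - 1) g (by simp only; omega) hg (Ne.symm hgl)
        have hy0 : y ≠ x₀ := by rintro rfl; rw [(hx _).2 (by simp)] at hyl; cases hyl
        have hy1 : y ≠ x₁ := by rintro rfl; rw [(hx _).2 (by simp)] at hyl; cases hyl
        have hxc : c x = c x₀ := by
          rcases (hx x).1 hxl with rfl | rfl | rfl <;> simp [hc, h1]
        -- Any path through the last edge has the colour of `x₀`, so the path `y` that separates `g`
        -- from it is forced to have colour `γ`.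
        refine Or.inr ⟨⟨x₀, by simp, by simp, hleaf _ h2 g hgl⟩, y, ?_, hyg, by simp [hy0, hy1]⟩
        rw [hxc] at hxy
        exact bool_eq_of_ne_of_ne hxy.symm (by simp)
    · refine ⟨some x₀, some x₁, none, by simpa using h01, by simp, by simp, hc, ?_, ?_⟩
      · rw [Function.update_self, Nat.add_sub_cancel]
        rintro (_ | x)
        · simp [hn1]
        · rw [hcov _ hA]
          simp
      · rw [Function.update_self, Nat.add_sub_cancel]
        refine Or.inr (Or.inr ⟨by simp [extendColour], by omega, rfl, ?_, ?_⟩)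
        · simp [extendFamily, h2, hstr1]
        · rw [covers_extendFamily_some _ _ _ _ _ (by simp; omega),
            show ℓ i + 1 - 2 = ℓ i - 1 by omega, hx]
          simp
  · refine main h1 fun g hg => ?_
    have h0g : covers (p x₀) g = true → g = (i, ℓ i - 1) ∨ g = (i, ℓ i - 2) := by
      rw [h4, covers_arm _ (Nat.sub_le _ _)]
      rintro ⟨h6, h7, h8⟩
      rw [← h6] at *
      by_cases h9 : g.2 = ℓ g.1 - 1
      · exact Or.inl (Prod.ext rfl h9)
      · exact Or.inr (Prod.ext rfl (by simp only; omega))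
    have hx1 : decide (x₁ = x₀ ∨ x₁ = x₂) = false := by simp [h01.symm, h12]
    by_cases hgl : g = (i, ℓ i - 1)
    · subst hgl
      exact Or.inl ⟨x₁, hc ▸ h1.symm, by simp [hx], hx1⟩
    by_cases hgl2 : g = (i, ℓ i - 2)
    · subst hgl2
      exact Or.inl ⟨x₁, hc ▸ h1.symm, h5, hx1⟩
    · obtain ⟨x, y, hxy, ⟨hxl, hxg⟩, hyg, hyl⟩ :=
        hS.sep (i, ℓ i - 1) g (by simp only; omega) hg (Ne.symm hgl)
      have hy0 : y ≠ x₀ := by rintro rfl; rw [(hx _).2 (by simp)] at hyl; cases hyl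
      have hy2 : y ≠ x₂ := by rintro rfl; rw [(hx _).2 (by simp)] at hyl; cases hyl
      by_cases hyc : c y = c x₂
      · refine Or.inr ⟨⟨x₀, h1.symm, by simp, ?_⟩, y, hyc, hyg, by simp [hy0, hy2]⟩
        by_contra h
        rcases h0g (by simpa using h) with h | h
        · exact hgl h
        · exact hgl2 h
      · exact Or.inl ⟨y, hyc, hyg, by simp [hy0, hy2]⟩

/-- The new edge lies in the new path, of colour `γ`, and in a prolonged path of the other colour;
this is what `hAγ` provides. -/
lemma Bicoloured.extend {ℓ : ι → ℕ} {p : κ → LegPath ι} {c : κ → Bool}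
    (hB : Bicoloured ℓ p c)
    (hv : ∀ x, (p x).1.2 ≤ ℓ (p x).1.1 ∧ (p x).2.2 ≤ ℓ (p x).2.1)
    {i : ι} (hi : 1 ≤ ℓ i) {γ : Bool} {A : κ → Bool}
    (hA : ∀ x, A x = true → covers (p x) (i, ℓ i - 1) = true)
    (hAγ : ∃ x, A x = true ∧ c x ≠ γ) :
    Bicoloured (Function.update ℓ i (ℓ i + 1)) (extendFamily p i (ℓ i) A) (extendColour c γ) := by
  intro e he δ
  by_cases hne : e = (i, ℓ i)
  · subst hne
    by_cases hδ : γ = δ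
    · exact ⟨none, hδ, by rw [covers_extendFamily_none]⟩
    · obtain ⟨x, hx1, hx2⟩ := hAγ
      refine ⟨some x, bool_eq_of_ne_of_ne hx2 (Ne.symm hδ), ?_⟩
      rw [covers_extendFamily_some_self p hv i hi A hA]
      exact hx1
  · obtain ⟨x, hx1, hx2⟩ := hB e (lt_of_lt_update he hne) δ
    refine ⟨some x, hx1, ?_⟩
    rwa [covers_extendFamily_some _ _ _ _ _ hne]

/-- Lengthening extendable legs: each additional edge costs one additional path. -/
lemma IsSep.exists_lengthen [Fintype ι] (J : ι → Prop) (ℓ' : ι → ℕ) (m : ℕ) :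
    ∀ (ℓ : ι → ℕ) (κ : Type) [Fintype κ] (p : κ → LegPath ι) (c : κ → Bool), IsSep ℓ p c →
      (∀ i, J i → Extendable ℓ p c i) → (∀ i, 2 ≤ ℓ i) → (∀ i, ℓ i ≤ ℓ' i) →
      (∀ i, ¬ J i → ℓ' i = ℓ i) → ∑ i, ℓ' i = ∑ i, ℓ i + m →
      ∃ (κ' : Type) (_ : Fintype κ') (p' : κ' → LegPath ι) (c' : κ' → Bool), IsSep ℓ' p' c' ∧
        Fintype.card κ' = Fintype.card κ + m ∧ (Bicoloured ℓ p c → Bicoloured ℓ' p' c') := by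
  induction m with
  | zero =>
    intro ℓ κ _ p c hS _ _ hle _ hsum
    have : ℓ = ℓ' := by
      funext i
      exact (Finset.sum_eq_sum_iff_of_le (fun i _ => hle i)).1 (by omega) i (Finset.mem_univ i)
    subst this
    exact ⟨κ, inferInstance, p, c, hS, rfl, id⟩
  | succ m ih =>
    intro ℓ κ _ p c hS hE h2 hle hJ hsum
    obtain ⟨i, hi⟩ : ∃ i, ℓ i < ℓ' i := by
      by_contra! h
      have := Finset.sum_le_sum (fun i (_ : i ∈ Finset.univ) => h i)
      omega
    have hJi : J i := by
      by_contra h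
      have := hJ i h
      omega
    obtain ⟨γ, A, hA, hAγ, hS', hE'⟩ := hS.extendable_step (h2 i) (hE i hJi)
    have hcase : ∀ j, (j = i ∧ Function.update ℓ i (ℓ i + 1) j = ℓ j + 1) ∨
        (j ≠ i ∧ Function.update ℓ i (ℓ i + 1) j = ℓ j) := by
      intro j
      by_cases h : j = i
      · subst h; simp
      · simp [h]
    obtain ⟨κ', hκ', p', c', hS'', hcard, hB⟩ := ih (Function.update ℓ i (ℓ i + 1)) (Option κ)
      (extendFamily p i (ℓ i) A) (extendColour c γ) hS'
      (fun j hj => by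
        by_cases h : j = i
        · subst h; exact hE'
        · exact (hE j hj).extendFamily_of_ne h γ A hA)
      (fun j => by have := h2 j; rcases hcase j with ⟨_, h⟩ | ⟨_, h⟩ <;> omega)
      (fun j => by
        have := hle j
        rcases hcase j with ⟨rfl, h⟩ | ⟨_, h⟩ <;> omega)
      (fun j hj => by
        have := hJ j hj
        rcases hcase j with ⟨rfl, h⟩ | ⟨_, h⟩
        · exact absurd hJi hj
        · omega)
      (by
        rw [hsum, Finset.sum_update_of_mem (Finset.mem_univ i),
          ← Finset.add_sum_erase _ ℓ (Finset.mem_univ i), Finset.sdiff_singleton_eq_erase]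
        omega)
    refine ⟨κ', hκ', p', c', hS'', ?_, fun h => hB (h.extend hS.valid ?_ hA hAγ)⟩
    · rw [hcard, Fintype.card_option]; omega
    · have := h2 i; omega

end Extendable

/-! ### Explicit systems on legs of length two. -/

/-- Checks separation for the spider all of whose legs have length two. -/
def sepCheck {q n : ℕ} (L : Fin n → LegPath (Fin q) × Bool) : Bool :=
  ((List.finRange n).all fun x => decide ((L x).1.1.2 ≤ 2 ∧ (L x).1.2.2 ≤ 2)) &&
  (List.finRange q).all fun i => (List.range 2).all fun d =>
    (List.finRange q).all fun j => (List.range 2).all fun d' =>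
      decide ((i, d) = (j, d')) ||
      (List.finRange n).any fun x => covers (L x).1 (i, d) && !covers (L x).1 (j, d') &&
        (List.finRange n).any fun y =>
          ((L x).2 != (L y).2) && covers (L y).1 (j, d') && !covers (L y).1 (i, d)

lemma isSep_of_sepCheck {q n : ℕ} {L : Fin n → LegPath (Fin q) × Bool} (h : sepCheck L = true) :
    IsSep (fun _ => 2) (fun x => (L x).1) (fun x => (L x).2) := by
  simp only [sepCheck, Bool.and_eq_true, List.all_eq_true, decide_eq_true_eq] at h
  refine ⟨fun x => h.1 x (List.mem_finRange _), fun e f he hf hne => ?_⟩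
  have := h.2 e.1 (List.mem_finRange _) e.2 (List.mem_range.2 he) f.1 (List.mem_finRange _) f.2
    (List.mem_range.2 hf)
  simp only [Prod.mk.eta, Bool.or_eq_true, decide_eq_true_eq, hne, false_or, List.any_eq_true,
    Bool.and_eq_true, Bool.not_eq_true', bne_iff_ne] at this
  obtain ⟨x, -, ⟨hX1, hX2⟩, y, -, ⟨hXY, hY1⟩, hY2⟩ := this
  exact ⟨x, y, hXY, ⟨hX1, hX2⟩, hY1, hY2⟩

/-- Checks the first two kinds of extendability with given witnesses. -/
def ExtendCheck {q n : ℕ} (L : Fin n → LegPath (Fin q) × Bool) (J : Fin q → Prop)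
    (w₀ w₁ w₂ : Fin q → Fin n) : Prop :=
  ∀ i, J i → w₀ i ≠ w₁ i ∧ w₀ i ≠ w₂ i ∧ w₁ i ≠ w₂ i ∧ (L (w₀ i)).2 = (L (w₁ i)).2 ∧
    (∀ x, covers (L x).1 (i, 1) = true ↔ x = w₀ i ∨ x = w₁ i ∨ x = w₂ i) ∧
    (L (w₀ i)).1 = ((i, 1), (i, 2))

lemma extendable_of_extendCheck {q n : ℕ} {L : Fin n → LegPath (Fin q) × Bool} {J : Fin q → Prop}
    {w₀ w₁ w₂ : Fin q → Fin n} (h : ExtendCheck L J w₀ w₁ w₂) (i : Fin q) (hi : J i) :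
    Extendable (fun _ => 2) (fun x => (L x).1) (fun x => (L x).2) i := by
  obtain ⟨h01, h02, h12, hc, hx, hp⟩ := h i hi
  refine ⟨w₀ i, w₁ i, w₂ i, h01, h02, h12, hc, hx, ?_⟩
  by_cases h : (L (w₂ i)).2 = (L (w₀ i)).2
  · exact Or.inr (Or.inl ⟨h, hp⟩)
  · exact Or.inl ⟨h, hp⟩

/-- A system for three legs of length two. -/
def threeLegs : Fin 8 → LegPath (Fin 3) × Bool :=
  ![(((0, 2), (1, 1)), false), (((1, 2), (2, 1)), false), (((2, 2), (0, 1)), false),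
    (((1, 2), (0, 2)), true), (((2, 2), (0, 1)), true), (((0, 1), (0, 2)), true),
    (((1, 1), (1, 2)), true), (((2, 1), (2, 2)), true)]

lemma threeLegs_sepCheck : sepCheck threeLegs = true := by decide +kernel

lemma threeLegs_extendCheck : ExtendCheck threeLegs (fun _ => True) ![5, 6, 7] ![3, 3, 4]
    ![0, 1, 2] := by
  unfold ExtendCheck; decide +kernel

/-- A system for four legs of length two. -/
def fourLegs : Fin 10 → LegPath (Fin 4) × Bool :=
  ![(((2, 2), (0, 2)), true), (((1, 1), (2, 1)), true), (((3, 2), (0, 2)), true),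
    (((3, 2), (1, 2)), false), (((0, 1), (3, 1)), false), (((2, 2), (1, 2)), false),
    (((0, 1), (0, 2)), true), (((1, 1), (1, 2)), false), (((2, 1), (2, 2)), false),
    (((3, 1), (3, 2)), true)]

lemma fourLegs_sepCheck : sepCheck fourLegs = true := by decide +kernel

lemma fourLegs_extendCheck : ExtendCheck fourLegs (fun _ => True) ![6, 7, 8, 9] ![0, 3, 5, 2]
    ![2, 5, 0, 3] := by
  unfold ExtendCheck; decide +kernel

/-- A system for five legs of length two. -/
def fiveLegs : Fin 13 → LegPath (Fin 5) × Bool :=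
  ![(((2, 2), (0, 2)), true), (((1, 1), (2, 1)), true), (((3, 2), (4, 1)), true),
    (((4, 2), (0, 2)), true), (((3, 2), (1, 2)), false), (((0, 1), (3, 1)), false),
    (((2, 2), (1, 2)), false), (((4, 2), (0, 0)), false), (((0, 1), (0, 2)), true),
    (((1, 1), (1, 2)), false), (((2, 1), (2, 2)), false), (((3, 1), (3, 2)), true),
    (((4, 1), (4, 2)), false)]

lemma fiveLegs_sepCheck : sepCheck fiveLegs = true := by decide +kernel

lemma fiveLegs_extendCheck : ExtendCheck fiveLegs (fun _ => True) ![8, 9, 10, 11, 12] ![0, 4, 6, 2, 7]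
    ![3, 6, 0, 4, 3] := by
  unfold ExtendCheck; decide +kernel

/-- A smaller system for five legs of length two, where legs `0` and `1` cannot be lengthened. -/
def fiveLegsShort : Fin 12 → LegPath (Fin 5) × Bool :=
  ![(((1, 2), (2, 1)), false), (((2, 2), (3, 1)), false), (((3, 2), (4, 1)), false),
    (((4, 2), (1, 1)), false), (((2, 2), (0, 2)), true), (((3, 2), (0, 2)), true),
    (((4, 2), (0, 1)), true), (((0, 1), (0, 2)), false), (((1, 1), (1, 2)), true),
    (((2, 1), (2, 2)), true), (((3, 1), (3, 2)), true), (((4, 1), (4, 2)), true)]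

lemma fiveLegsShort_sepCheck : sepCheck fiveLegsShort = true := by decide +kernel

/-- The zeros listed for legs `0` and `1` are placeholders, as nothing is required of these legs. -/
lemma fiveLegsShort_extendCheck : ExtendCheck fiveLegsShort (fun i => 2 ≤ i.val) ![0, 0, 9, 10, 11] ![0, 0, 4, 5, 6]
    ![0, 0, 1, 2, 3] := by
  unfold ExtendCheck; decide +kernel

/-- A smaller system for six legs of length two, where legs `0` and `1` cannot be lengthened. -/
def sixLegsShort : Fin 15 → LegPath (Fin 6) × Bool :=
  ![(((1, 2), (2, 1)), false), (((2, 2), (3, 1)), false), (((3, 2), (4, 1)), false),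
    (((4, 2), (5, 1)), false), (((5, 2), (1, 1)), false), (((2, 2), (0, 2)), true),
    (((3, 2), (0, 2)), true), (((4, 2), (0, 1)), true), (((5, 2), (0, 0)), true),
    (((0, 1), (0, 2)), false), (((1, 1), (1, 2)), true), (((2, 1), (2, 2)), true),
    (((3, 1), (3, 2)), true), (((4, 1), (4, 2)), true), (((5, 1), (5, 2)), true)]

lemma sixLegsShort_sepCheck : sepCheck sixLegsShort = true := by decide +kernel

lemma sixLegsShort_extendCheck : ExtendCheck sixLegsShort (fun i => 2 ≤ i.val) ![0, 0, 11, 12, 13, 14] ![0, 0, 5, 6, 7, 8]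
    ![0, 0, 1, 2, 3, 4] := by
  unfold ExtendCheck; decide +kernel

lemma threeLegs_bicoloured :
    Bicoloured (fun _ => 2) (fun x => (threeLegs x).1) (fun x => (threeLegs x).2) := by
  have : ∀ (i : Fin 3) (d : Fin 2) (γ : Bool), ∃ x,
      (threeLegs x).2 = γ ∧ covers (threeLegs x).1 (i, d.val) = true := by decide +kernel
  intro e he γ
  exact this e.1 ⟨e.2, he⟩ γ

/-- There is a separating family of `M` paths for leg lengths `ℓ`. -/
def HasSep {ι : Type*} [DecidableEq ι] (ℓ : ι → ℕ) (M : ℕ) : Prop :=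
  ∃ (κ : Type) (_ : Fintype κ) (p : κ → LegPath ι) (c : κ → Bool),
    IsSep ℓ p c ∧ Fintype.card κ = M

/-- There is a separating family of `M` paths for leg lengths `ℓ` in which each edge lies in paths
of both colours. -/
def HasBicolouredSep {ι : Type*} [DecidableEq ι] (ℓ : ι → ℕ) (M : ℕ) : Prop :=
  ∃ (κ : Type) (_ : Fintype κ) (p : κ → LegPath ι) (c : κ → Bool),
    IsSep ℓ p c ∧ Fintype.card κ = M ∧ Bicoloured ℓ p c

/-! ### Relabelling legs and joining spiders at the centre. -/

section Map

variable {ι ι' : Type*} [DecidableEq ι] [DecidableEq ι']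

/-- Relabel the legs. -/
def LegPath.map (f : ι → ι') (P : LegPath ι) : LegPath ι' := ((f P.1.1, P.1.2), (f P.2.1, P.2.2))

lemma covers_map {f : ι → ι'} (hf : Function.Injective f) (P : LegPath ι) (k : ι) (d : ℕ) :
    covers (P.map f) (f k, d) = covers P (k, d) := by
  simp [covers, LegPath.map, hf.eq_iff]

lemma covers_map_of_notMem {ι : Type*} {f : ι → ι'} (P : LegPath ι) {k : ι'} (hk : ∀ i, f i ≠ k) (d : ℕ) :
    covers (P.map f) (k, d) = false := by
  simp [covers, LegPath.map, (hk _).symm]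

lemma HasSep.of_equiv {ℓ : ι' → ℕ} {M : ℕ} (σ : ι ≃ ι') (h : HasSep (ℓ ∘ σ) M) : HasSep ℓ M := by
  obtain ⟨κ, hκ, p, c, hS, hM⟩ := h
  refine ⟨κ, hκ, fun x => (p x).map σ, c, ⟨fun x => hS.valid x, ?_⟩, hM⟩
  rintro ⟨i, d⟩ ⟨j, d'⟩ he hf hne
  obtain ⟨i, rfl⟩ := σ.surjective i
  obtain ⟨j, rfl⟩ := σ.surjective j
  simp only [covers_map σ.injective]
  refine hS.sep (i, d) (j, d') he hf fun h => hne ?_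
  rw [Prod.mk.injEq] at h ⊢
  exact ⟨congrArg σ h.1, h.2⟩

lemma HasBicolouredSep.of_equiv {ℓ : ι' → ℕ} {M : ℕ} (σ : ι ≃ ι')
    (h : HasBicolouredSep (ℓ ∘ σ) M) : HasBicolouredSep ℓ M := by
  obtain ⟨κ, hκ, p, c, hS, hM, hB⟩ := h
  refine ⟨κ, hκ, fun x => (p x).map σ, c, ⟨fun x => hS.valid x, ?_⟩, hM, ?_⟩
  · rintro ⟨i, d⟩ ⟨j, d'⟩ he hf hne
    obtain ⟨i, rfl⟩ := σ.surjective i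
    obtain ⟨j, rfl⟩ := σ.surjective j
    simp only [covers_map σ.injective]
    refine hS.sep (i, d) (j, d') he hf fun h => hne ?_
    rw [Prod.mk.injEq] at h ⊢
    exact ⟨congrArg σ h.1, h.2⟩
  · rintro ⟨i, d⟩ he γ
    obtain ⟨i, rfl⟩ := σ.surjective i
    obtain ⟨x, hx1, hx2⟩ := hB (i, d) he γ
    exact ⟨x, hx1, by rw [covers_map σ.injective]; exact hx2⟩

lemma IsSep.exists_covers {κ : Type*} {ℓ : ι → ℕ} {p : κ → LegPath ι} {c : κ → Bool}
    (hS : IsSep ℓ p c) (h2 : ∀ i, 2 ≤ ℓ i) (e : ι × ℕ) (he : e.2 < ℓ e.1) :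
    ∃ x, covers (p x) e = true := by
  have := h2 e.1
  obtain ⟨x, -, -, ⟨hx, -⟩, -⟩ := hS.sep e (e.1, if e.2 = 0 then 1 else 0) he
    (by simp only; split_ifs <;> omega)
    (fun h => by
      have h' := congrArg Prod.snd h
      simp only at h'
      split_ifs at h' <;> omega)
  exact ⟨x, hx⟩

/-- The union of two families on disjoint sets of legs. -/
def sumFamily {κ κ' : Type*} (p : κ → LegPath ι) (p' : κ' → LegPath ι') :
    κ ⊕ κ' → LegPath (ι ⊕ ι') :=
  Sum.elim (fun x => (p x).map Sum.inl) (fun x => (p' x).map Sum.inr)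

section Sum

variable {κ κ' : Type*} (p : κ → LegPath ι) (p' : κ' → LegPath ι')

lemma covers_sumFamily_inl_inl (x : κ) (k : ι) (d : ℕ) :
    covers (sumFamily p p' (Sum.inl x)) (Sum.inl k, d) = covers (p x) (k, d) :=
  covers_map Sum.inl_injective _ _ _

lemma covers_sumFamily_inr_inr (x : κ') (k : ι') (d : ℕ) :
    covers (sumFamily p p' (Sum.inr x)) (Sum.inr k, d) = covers (p' x) (k, d) :=
  covers_map Sum.inr_injective _ _ _

lemma covers_sumFamily_inl_inr (x : κ) (k : ι') (d : ℕ) :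
    covers (sumFamily p p' (Sum.inl x)) (Sum.inr k, d) = false :=
  covers_map_of_notMem _ (fun _ => Sum.inl_ne_inr) _

lemma covers_sumFamily_inr_inl (x : κ') (k : ι) (d : ℕ) :
    covers (sumFamily p p' (Sum.inr x)) (Sum.inl k, d) = false :=
  covers_map_of_notMem _ (fun _ => Sum.inr_ne_inl) _

variable {p p'}

/-- Only pairs of edges from different parts are new. Any path through the first edge may be used,
because the bicoloured part offers a path of the opposite colour through the second; neither path
meets the other part. -/
lemma IsSep.sum {ℓ : ι → ℕ} {ℓ' : ι' → ℕ} {c : κ → Bool} {c' : κ' → Bool} (hS : IsSep ℓ p c)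
    (hS' : IsSep ℓ' p' c') (hB : Bicoloured ℓ' p' c') (h2 : ∀ i, 2 ≤ ℓ i) :
    IsSep (Sum.elim ℓ ℓ') (sumFamily p p') (Sum.elim c c') := by
  have mixed : ∀ (i : ι) (d : ℕ) (j : ι') (d' : ℕ), d < ℓ i → d' < ℓ' j →
      ∃ x y, Sum.elim c c' x ≠ Sum.elim c c' y ∧
        (covers (sumFamily p p' x) (Sum.inl i, d) = true ∧
          covers (sumFamily p p' x) (Sum.inr j, d') = false) ∧
        (covers (sumFamily p p' y) (Sum.inr j, d') = true ∧
          covers (sumFamily p p' y) (Sum.inl i, d) = false) := by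
    intro i d j d' hd hd'
    obtain ⟨x, hx⟩ := hS.exists_covers h2 (i, d) hd
    obtain ⟨y, hy1, hy2⟩ := hB (j, d') hd' (!c x)
    refine ⟨Sum.inl x, Sum.inr y, by simp [hy1], ⟨?_, ?_⟩, ?_, ?_⟩
    · rwa [covers_sumFamily_inl_inl]
    · rw [covers_sumFamily_inl_inr]
    · rwa [covers_sumFamily_inr_inr]
    · rw [covers_sumFamily_inr_inl]
  refine ⟨?_, ?_⟩
  · rintro (x | x)
    · exact hS.valid x
    · exact hS'.valid x
  · rintro ⟨i | i, d⟩ ⟨j | j, d'⟩ he hf hne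
    · obtain ⟨x, y, h⟩ := hS.sep (i, d) (j, d') he hf fun h => hne (by
        rw [Prod.mk.injEq] at h ⊢; exact ⟨congrArg _ h.1, h.2⟩)
      exact ⟨Sum.inl x, Sum.inl y, by simpa only [Sum.elim_inl, covers_sumFamily_inl_inl] using h⟩
    · exact mixed i d j d' he hf
    · obtain ⟨x, y, h1, h2, h3⟩ := mixed j d' i d hf he
      exact ⟨y, x, h1.symm, h3, h2⟩
    · obtain ⟨x, y, h⟩ := hS'.sep (i, d) (j, d') he hf fun h => hne (by
        rw [Prod.mk.injEq] at h ⊢; exact ⟨congrArg _ h.1, h.2⟩)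
      exact ⟨Sum.inr x, Sum.inr y, by simpa only [Sum.elim_inr, covers_sumFamily_inr_inr] using h⟩

lemma Bicoloured.sum {ℓ : ι → ℕ} {ℓ' : ι' → ℕ} {c : κ → Bool} {c' : κ' → Bool}
    (hB : Bicoloured ℓ p c) (hB' : Bicoloured ℓ' p' c') :
    Bicoloured (Sum.elim ℓ ℓ') (sumFamily p p') (Sum.elim c c') := by
  rintro ⟨i | i, d⟩ he γ
  · obtain ⟨x, h⟩ := hB (i, d) he γ
    exact ⟨Sum.inl x, by simpa only [Sum.elim_inl, covers_sumFamily_inl_inl] using h⟩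
  · obtain ⟨x, h⟩ := hB' (i, d) he γ
    exact ⟨Sum.inr x, by simpa only [Sum.elim_inr, covers_sumFamily_inr_inr] using h⟩

end Sum

lemma HasSep.sum {ℓ : ι ⊕ ι' → ℕ} {M M' : ℕ} (h : HasSep (ℓ ∘ Sum.inl) M)
    (h' : HasBicolouredSep (ℓ ∘ Sum.inr) M') (h2 : ∀ i, 2 ≤ ℓ i) : HasSep ℓ (M + M') := by
  obtain ⟨κ, _, p, c, hS, hM⟩ := h
  obtain ⟨κ', _, p', c', hS', hM', hB'⟩ := h'
  have := hS.sum hS' hB' (fun i => h2 _)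
  rw [Sum.elim_comp_inl_inr] at this
  exact ⟨κ ⊕ κ', inferInstance, _, _, this, by rw [Fintype.card_sum, hM, hM']⟩

lemma HasBicolouredSep.sum {ℓ : ι ⊕ ι' → ℕ} {M M' : ℕ} (h : HasBicolouredSep (ℓ ∘ Sum.inl) M)
    (h' : HasBicolouredSep (ℓ ∘ Sum.inr) M') (h2 : ∀ i, 2 ≤ ℓ i) :
    HasBicolouredSep ℓ (M + M') := by
  obtain ⟨κ, _, p, c, hS, hM, hB⟩ := h
  obtain ⟨κ', _, p', c', hS', hM', hB'⟩ := h'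
  have := hS.sum hS' hB' (fun i => h2 _)
  have hB'' := hB.sum hB'
  rw [Sum.elim_comp_inl_inr] at this hB''
  exact ⟨κ ⊕ κ', inferInstance, _, _, this, by rw [Fintype.card_sum, hM, hM'], hB''⟩

end Map

/-! ### Upper bounds for arbitrary leg lengths. -/

/-- Lengthening a system for legs of length two. -/
lemma exists_isSep_of_checks {q N : ℕ} {L : Fin N → LegPath (Fin q) × Bool} {J : Fin q → Prop}
    {w₀ w₁ w₂ : Fin q → Fin N} (hs : sepCheck L = true) (he : ExtendCheck L J w₀ w₁ w₂)
    (ℓ : Fin q → ℕ) (h2 : ∀ i, 2 ≤ ℓ i) (hJ : ∀ i, ¬ J i → ℓ i = 2) {r : ℕ} (hr : N = 2 * q + r) :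
    ∃ (κ : Type) (_ : Fintype κ) (p : κ → LegPath (Fin q)) (c : κ → Bool),
      IsSep ℓ p c ∧ Fintype.card κ = ∑ i, ℓ i + r ∧
      (Bicoloured (fun _ => 2) (fun x => (L x).1) (fun x => (L x).2) → Bicoloured ℓ p c) := by
  have hle : 2 * q ≤ ∑ i, ℓ i := by
    have := Finset.sum_le_sum (fun i (_ : i ∈ Finset.univ) => h2 i)
    simpa [mul_comm] using this
  obtain ⟨κ, hκ, p, c, hS, hcard, hB⟩ := (isSep_of_sepCheck hs).exists_lengthen J ℓ
    (∑ i, ℓ i - 2 * q) (fun _ => 2) (Fin N) _ _ (fun i hi => extendable_of_extendCheck he i hi)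
    (fun _ => le_rfl) h2 hJ (by simp; omega)
  refine ⟨κ, hκ, p, c, hS, ?_, hB⟩
  rw [hcard, Fintype.card_fin]
  omega

lemma hasBicolouredSep_three (ℓ : Fin 3 → ℕ) (h2 : ∀ i, 2 ≤ ℓ i) :
    HasBicolouredSep ℓ (∑ i, ℓ i + 2) := by
  obtain ⟨κ, hκ, p, c, hS, hc, hB⟩ := exists_isSep_of_checks threeLegs_sepCheck
    threeLegs_extendCheck ℓ h2 (fun i h => absurd trivial h) (r := 2) rfl
  exact ⟨κ, hκ, p, c, hS, hc, hB threeLegs_bicoloured⟩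

lemma hasBicolouredSep_three_mul (t : ℕ) (ℓ : Fin (3 * t) → ℕ) (h2 : ∀ i, 2 ≤ ℓ i) :
    HasBicolouredSep ℓ (∑ i, ℓ i + 2 * t) := by
  induction t with
  | zero =>
    refine ⟨Empty, inferInstance, Empty.elim, Empty.elim, ⟨fun x => x.elim, fun e => ?_⟩, ?_,
      fun e => ?_⟩
    · exact e.1.elim0
    · simp
    · exact e.1.elim0
  | succ t ih =>
    let σ : Fin (3 * t) ⊕ Fin 3 ≃ Fin (3 * (t + 1)) := finSumFinEquiv
    have h := HasBicolouredSep.sum (ℓ := ℓ ∘ σ) (ih (ℓ ∘ σ ∘ Sum.inl) fun i => h2 _)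
      (hasBicolouredSep_three (ℓ ∘ σ ∘ Sum.inr) fun i => h2 _) (fun i => h2 _)
    have h' := h.of_equiv σ
    convert h' using 1
    rw [← Equiv.sum_comp σ, Fintype.sum_sum_type]
    simp only [Function.comp]
    omega

lemma HasSep.add_threes {m t r q : ℕ} (σ : Fin m ⊕ Fin (3 * t) ≃ Fin q) (ℓ : Fin q → ℕ)
    (h2 : ∀ i, 2 ≤ ℓ i) (h : HasSep (ℓ ∘ σ ∘ Sum.inl) (∑ i, (ℓ ∘ σ ∘ Sum.inl) i + r)) :
    HasSep ℓ (∑ i, ℓ i + (r + 2 * t)) := by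
  have h' := (HasSep.sum (ℓ := ℓ ∘ σ) h (hasBicolouredSep_three_mul t (ℓ ∘ σ ∘ Sum.inr)
    fun i => h2 _) (fun i => h2 _)).of_equiv σ
  convert h' using 1
  rw [← Equiv.sum_comp σ, Fintype.sum_sum_type]
  simp only [Function.comp]
  omega

/-- Used to place two given legs of length two at the positions `0` and `1` that the smaller systems
cannot lengthen. Two successive transpositions suffice. -/
lemma exists_equiv_map_pair {m t q : ℕ} (h : m + t = q) {a b : Fin m} (hab : a ≠ b) {i j : Fin q}
    (hij : i ≠ j) : ∃ σ : Fin m ⊕ Fin t ≃ Fin q, σ (Sum.inl a) = i ∧ σ (Sum.inl b) = j := by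
  let τ : Fin m ⊕ Fin t ≃ Fin q := finSumFinEquiv.trans (finCongr h)
  have hτ : τ (Sum.inl a) ≠ τ (Sum.inl b) := fun h => hab (Sum.inl_injective (τ.injective h))
  set u := τ (Sum.inl a)
  set v := τ (Sum.inl b)
  refine ⟨τ.trans ((Equiv.swap u i).trans (Equiv.swap (Equiv.swap u i v) j)), ?_, ?_⟩
  · change Equiv.swap (Equiv.swap u i v) j (Equiv.swap u i u) = i
    rw [Equiv.swap_apply_left]
    refine Equiv.swap_apply_of_ne_of_ne (fun h => hτ ?_) hij
    have h' := congrArg (Equiv.swap u i) h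
    rwa [Equiv.swap_apply_right, Equiv.swap_apply_self] at h'
  · change Equiv.swap (Equiv.swap u i v) j (Equiv.swap u i v) = j
    rw [Equiv.swap_apply_left]

lemma hasSep_four_add {q t : ℕ} (hq : 4 + 3 * t = q) (ℓ : Fin q → ℕ)
    (h2 : ∀ i, 2 ≤ ℓ i) :
    HasSep ℓ (∑ i, ℓ i + (2 + 2 * t)) := by
  obtain ⟨κ, hκ, p, c, hS, hc, -⟩ := exists_isSep_of_checks fourLegs_sepCheck
    fourLegs_extendCheck (ℓ ∘ (finSumFinEquiv.trans (finCongr hq)) ∘ Sum.inl) (fun i => h2 _)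
    (fun i h => absurd trivial h) (r := 2) rfl
  exact HasSep.add_threes (finSumFinEquiv.trans (finCongr hq)) ℓ h2 ⟨κ, hκ, p, c, hS, hc⟩

lemma hasSep_five_add {q t : ℕ} (hq : 5 + 3 * t = q) (ℓ : Fin q → ℕ)
    (h2 : ∀ i, 2 ≤ ℓ i) :
    HasSep ℓ (∑ i, ℓ i + (3 + 2 * t)) := by
  obtain ⟨κ, hκ, p, c, hS, hc, -⟩ := exists_isSep_of_checks fiveLegs_sepCheck
    fiveLegs_extendCheck (ℓ ∘ (finSumFinEquiv.trans (finCongr hq)) ∘ Sum.inl) (fun i => h2 _)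
    (fun i h => absurd trivial h) (r := 3) rfl
  exact HasSep.add_threes (finSumFinEquiv.trans (finCongr hq)) ℓ h2 ⟨κ, hκ, p, c, hS, hc⟩

lemma eq_two_of_short {m t q : ℕ} {ℓ : Fin q → ℕ} {σ : Fin (m + 2) ⊕ Fin t ≃ Fin q}
    {i j : Fin q} (hi : ℓ i = 2) (hj : ℓ j = 2) (h0 : σ (Sum.inl 0) = i) (h1 : σ (Sum.inl 1) = j)
    (k : Fin (m + 2)) (hk : ¬ 2 ≤ k.val) : (ℓ ∘ σ ∘ Sum.inl) k = 2 := by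
  have : k = 0 ∨ k = 1 := by
    rcases k with ⟨k, h⟩
    have : k = 0 ∨ k = 1 := by simp only at hk; omega
    rcases this with rfl | rfl
    · exact Or.inl rfl
    · exact Or.inr (by ext; simp)
  rcases this with rfl | rfl
  · simpa [h0] using hi
  · simpa [h1] using hj

lemma hasSep_five_add_of_short {q t : ℕ} (hq : 5 + 3 * t = q) (ℓ : Fin q → ℕ)
    (h2 : ∀ i, 2 ≤ ℓ i)
    {i j : Fin q} (hij : i ≠ j) (hi : ℓ i = 2) (hj : ℓ j = 2) :
    HasSep ℓ (∑ i, ℓ i + (2 + 2 * t)) := by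
  obtain ⟨σ, h0, h1⟩ := exists_equiv_map_pair (m := 5) (t := 3 * t) hq zero_ne_one hij
  obtain ⟨κ, hκ, p, c, hS, hc, -⟩ := exists_isSep_of_checks fiveLegsShort_sepCheck
    fiveLegsShort_extendCheck (ℓ ∘ σ ∘ Sum.inl) (fun i => h2 _)
    (eq_two_of_short (m := 3) hi hj h0 h1) (r := 2) rfl
  exact HasSep.add_threes σ ℓ h2 ⟨κ, hκ, p, c, hS, hc⟩

lemma hasSep_six_add_of_short {q t : ℕ} (hq : 6 + 3 * t = q) (ℓ : Fin q → ℕ)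
    (h2 : ∀ i, 2 ≤ ℓ i)
    {i j : Fin q} (hij : i ≠ j) (hi : ℓ i = 2) (hj : ℓ j = 2) :
    HasSep ℓ (∑ i, ℓ i + (3 + 2 * t)) := by
  obtain ⟨σ, h0, h1⟩ := exists_equiv_map_pair (m := 6) (t := 3 * t) hq zero_ne_one hij
  obtain ⟨κ, hκ, p, c, hS, hc, -⟩ := exists_isSep_of_checks sixLegsShort_sepCheck
    sixLegsShort_extendCheck (ℓ ∘ σ ∘ Sum.inl) (fun i => h2 _)
    (eq_two_of_short (m := 4) hi hj h0 h1) (r := 3) rfl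
  exact HasSep.add_threes σ ℓ h2 ⟨κ, hκ, p, c, hS, hc⟩

/-! ### The lower bound by weighted counting. -/

section Lower

variable {ι κ : Type*} [DecidableEq ι]

/-- The number of end vertices at distance at least `a` from the centre on leg `k`. -/
def endCount (k : ι) (a : ℕ) (P : LegPath ι) : ℕ :=
  (if k = P.1.1 ∧ a ≤ P.1.2 then 1 else 0) + (if k = P.2.1 ∧ a ≤ P.2.2 then 1 else 0)

lemma covers_le_endCount (k : ι) (d : ℕ) (P : LegPath ι) :
    (if covers P (k, d) = true then 1 else 0) ≤ endCount k (d + 1) P := by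
  have key : ∀ (A B : Prop) [Decidable A] [Decidable B],
      (if xor (decide A) (decide B) = true then 1 else 0) ≤
        (if A then 1 else 0) + (if B then 1 else 0) := by
    intro A B _ _
    by_cases hA : A <;> by_cases hB : B <;> simp [hA, hB]
  exact key (k = P.1.1 ∧ d < P.1.2) (k = P.2.1 ∧ d < P.2.2)

/-- A path that contains exactly one of two consecutive edges of a leg has an end at the vertex
between them, and this end is counted at depth `d + 1` but not at `d + 2`. -/
lemma endCount_succ_add_le (k : ι) (d : ℕ) (P : LegPath ι) :
    endCount k (d + 2) P + (if covers P (k, d) = true ∧ covers P (k, d + 1) = false then 1 else 0)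
      + (if covers P (k, d) = false ∧ covers P (k, d + 1) = true then 1 else 0)
      ≤ endCount k (d + 1) P := by
  have key : ∀ (A B A' B' : Prop) [Decidable A] [Decidable B] [Decidable A'] [Decidable B'],
      (A' → A) → (B' → B) →
      (if A' then 1 else 0) + (if B' then 1 else 0) +
        (if xor (decide A) (decide B) = true ∧ xor (decide A') (decide B') = false then 1 else 0) +
        (if xor (decide A) (decide B) = false ∧ xor (decide A') (decide B') = true then 1 else 0) ≤
        (if A then 1 else 0) + (if B then 1 else 0) := by
    intro A B A' B' _ _ _ _ h h'
    by_cases hA' : A' <;> by_cases hB' : B'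
    · simp [hA', hB', h hA', h' hB']
    · by_cases hB : B <;> simp [hA', hB', h hA', hB]
    · by_cases hA : A <;> simp [hA', hB', h' hB', hA]
    · by_cases hA : A <;> by_cases hB : B <;> simp [hA', hB', hA, hB]
  exact key (k = P.1.1 ∧ d < P.1.2) (k = P.2.1 ∧ d < P.2.2) (k = P.1.1 ∧ d + 1 < P.1.2)
    (k = P.2.1 ∧ d + 1 < P.2.2) (fun h => ⟨h.1, by omega⟩) (fun h => ⟨h.1, by omega⟩)

variable [Fintype κ]

/-- The paths of colour `γ` that contain the edge `e`. -/
def colourClass (p : κ → LegPath ι) (c : κ → Bool) (γ : Bool) (e : ι × ℕ) : Finset κ :=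
  Finset.univ.filter fun x => c x = γ ∧ covers (p x) e = true

lemma mem_colourClass {p : κ → LegPath ι} {c : κ → Bool} {γ : Bool} {e : ι × ℕ} {x : κ} :
    x ∈ colourClass p c γ e ↔ c x = γ ∧ covers (p x) e = true := by
  simp [colourClass]

lemma sum_ite_covers (p : κ → LegPath ι) (c : κ → Bool) (e : ι × ℕ) :
    ∑ x, (if covers (p x) e = true then 1 else 0) =
      (colourClass p c true e).card + (colourClass p c false e).card := by
  rw [colourClass, colourClass, Finset.card_filter, Finset.card_filter, ← Finset.sum_add_distrib]
  refine Finset.sum_congr rfl fun x _ => ?_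
  cases c x <;> simp

variable [DecidableEq κ] {ℓ : ι → ℕ} {p : κ → LegPath ι} {c : κ → Bool}

lemma IsSep.colourClass_sdiff (hS : IsSep ℓ p c) {e f : ι × ℕ} (he : e.2 < ℓ e.1)
    (hf : f.2 < ℓ f.1) (hne : e ≠ f) :
    ∃ γ, (colourClass p c γ e \ colourClass p c γ f).Nonempty ∧
      (colourClass p c (!γ) f \ colourClass p c (!γ) e).Nonempty := by
  obtain ⟨x, y, hxy, ⟨h1, h2⟩, h3, h4⟩ := hS.sep e f he hf hne
  refine ⟨c x, ⟨x, ?_⟩, y, ?_⟩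
  · simp [mem_colourClass, h1, h2]
  · have : c y = !c x := bool_eq_of_ne_of_ne hxy.symm (by simp)
    simp [mem_colourClass, h3, h4, this]

/-- The two separating paths have different colours, so each colour contains one of them, and that
path lies in just one of its two classes. -/
lemma IsSep.colourClass_ne (hS : IsSep ℓ p c) {e f : ι × ℕ} (he : e.2 < ℓ e.1)
    (hf : f.2 < ℓ f.1) (hne : e ≠ f) (γ : Bool) :
    colourClass p c γ e ≠ colourClass p c γ f := by
  intro h
  obtain ⟨δ, h1, h2⟩ := hS.colourClass_sdiff he hf hne
  by_cases hδ : δ = γ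
  · subst hδ
    rw [h, sdiff_self] at h1
    exact Finset.not_nonempty_empty h1
  · have : (!δ) = γ := by cases δ <;> cases γ <;> simp_all
    rw [this, h, sdiff_self] at h2
    exact Finset.not_nonempty_empty h2

lemma sum_ite_covers_not (p : κ → LegPath ι) (c : κ → Bool) (e f : ι × ℕ) :
    ∑ x, (if covers (p x) e = true ∧ covers (p x) f = false then 1 else 0) =
      (colourClass p c true e \ colourClass p c true f).card +
      (colourClass p c false e \ colourClass p c false f).card := by
  have : ∀ γ, colourClass p c γ e \ colourClass p c γ f = Finset.univ.filter fun x =>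
      c x = γ ∧ covers (p x) e = true ∧ covers (p x) f = false := by
    intro γ
    ext x
    simp only [Finset.mem_sdiff, mem_colourClass, Finset.mem_filter, Finset.mem_univ, true_and]
    cases covers (p x) e <;> cases covers (p x) f <;> simp
  rw [this, this, Finset.card_filter, Finset.card_filter, ← Finset.sum_add_distrib]
  refine Finset.sum_congr rfl fun x _ => ?_
  cases c x <;> simp

/-- At an inner vertex of a leg, the end vertices account for the change of the set of paths. -/
lemma sum_endCount_succ_add_le (p : κ → LegPath ι) (c : κ → Bool) (k : ι) (d : ℕ) :
    ∑ x, endCount k (d + 2) (p x) +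
      ((colourClass p c true (k, d) \ colourClass p c true (k, d + 1)).card +
        (colourClass p c false (k, d) \ colourClass p c false (k, d + 1)).card) +
      ((colourClass p c true (k, d + 1) \ colourClass p c true (k, d)).card +
        (colourClass p c false (k, d + 1) \ colourClass p c false (k, d)).card) ≤
    ∑ x, endCount k (d + 1) (p x) := by
  rw [← sum_ite_covers_not, ← sum_ite_covers_not, ← Finset.sum_add_distrib,
    ← Finset.sum_add_distrib]
  refine Finset.sum_le_sum fun x _ => ?_
  have := endCount_succ_add_le k d (p x)
  simpa only [and_comm] using this

lemma card_eq_inter_add_sdiff {α : Type*} [DecidableEq α] (s t : Finset α) :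
    s.card = (s ∩ t).card + (s \ t).card := by
  have := Finset.card_inter_add_card_sdiff s t
  omega

/-- Induction from the leaf towards the centre. A path through edge `d + 1` but not edge `d` ends
between them, which raises the end count by one while lowering the class size by one. At least one
such path exists at each inner vertex, whence the gain of 2. -/
lemma IsSep.colourClass_add_le_endCount (hS : IsSep ℓ p c) (k : ι) (m : ℕ) :
    ∀ d, d + 1 + m = ℓ k →
      (colourClass p c true (k, d)).card + (colourClass p c false (k, d)).card + 2 * m ≤
        ∑ x, endCount k (d + 1) (p x) := by
  induction m with
  | zero =>
    intro d _
    rw [← sum_ite_covers]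
    exact Finset.sum_le_sum fun x _ => covers_le_endCount k d (p x)
  | succ m ih =>
    intro d hd
    have h1 := ih (d + 1) (by omega)
    rw [show d + 1 + 1 = d + 2 from rfl] at h1
    have h2 := sum_endCount_succ_add_le p c k d
    have a1 := card_eq_inter_add_sdiff (colourClass p c true (k, d))
      (colourClass p c true (k, d + 1))
    have a2 := card_eq_inter_add_sdiff (colourClass p c false (k, d))
      (colourClass p c false (k, d + 1))
    have a3 := card_eq_inter_add_sdiff (colourClass p c true (k, d + 1))
      (colourClass p c true (k, d))
    have a4 := card_eq_inter_add_sdiff (colourClass p c false (k, d + 1))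
      (colourClass p c false (k, d))
    rw [Finset.inter_comm] at a3 a4
    have h3 : 1 ≤ (colourClass p c true (k, d + 1) \ colourClass p c true (k, d)).card +
        (colourClass p c false (k, d + 1) \ colourClass p c false (k, d)).card := by
      obtain ⟨γ, hγ, -⟩ := hS.colourClass_sdiff (e := (k, d + 1)) (f := (k, d))
        (by simp only; omega) (by simp only; omega) (by simp)
      have := hγ.card_pos
      cases γ <;> omega
    omega

/-- The path `x` contains the innermost edge of leg `k`, and is the only path of its colour through
one of the two innermost edges of that leg. -/
def IsBound (p : κ → LegPath ι) (c : κ → Bool) (k : ι) (x : κ) : Prop :=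
  covers (p x) (k, 0) = true ∧
    (colourClass p c (c x) (k, 0) = {x} ∨ colourClass p c (c x) (k, 1) = {x})

instance (p : κ → LegPath ι) (c : κ → Bool) (k : ι) (x : κ) : Decidable (IsBound p c k x) :=
  inferInstanceAs (Decidable (_ ∧ _))

/-- The weight of path `x` on leg `k`: `1` or `-1` for paths through the innermost edge, according
to whether they are bound. -/
def boundWeight (p : κ → LegPath ι) (c : κ → Bool) (k : ι) (x : κ) : ℤ :=
  if covers (p x) (k, 0) = true then if IsBound p c k x then 1 else -1 else 0

lemma sum_boundWeight (p : κ → LegPath ι) (c : κ → Bool) (k : ι) :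
    ∑ x, boundWeight p c k x =
      2 * ((Finset.univ.filter fun x => c x = true ∧ IsBound p c k x).card +
        (Finset.univ.filter fun x => c x = false ∧ IsBound p c k x).card : ℤ) -
      ((colourClass p c true (k, 0)).card + (colourClass p c false (k, 0)).card : ℤ) := by
  have h : ((colourClass p c true (k, 0)).card + (colourClass p c false (k, 0)).card : ℤ) =
      ∑ x, (if covers (p x) (k, 0) = true then 1 else 0 : ℤ) := by
    have := sum_ite_covers p c (k, 0)
    exact_mod_cast this.symm
  rw [h, Finset.card_filter, Finset.card_filter]
  push_cast
  rw [← Finset.sum_add_distrib, Finset.mul_sum, ← Finset.sum_sub_distrib]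
  refine Finset.sum_congr rfl fun x _ => ?_
  unfold boundWeight
  have hb : IsBound p c k x → covers (p x) (k, 0) = true := fun h => h.1
  by_cases h1 : covers (p x) (k, 0) = true <;> by_cases h2 : IsBound p c k x
  · cases c x <;> simp [h1, h2]
  · cases c x <;> simp [h1, h2]
  · exact absurd (hb h2) h1
  · cases c x <;> simp [h1, h2]

lemma one_le_card_isBound (p : κ → LegPath ι) (c : κ → Bool) (k : ι) (γ : Bool)
    (h : (colourClass p c γ (k, 0)).card = 1 ∨
      ((colourClass p c γ (k, 0) ∩ colourClass p c γ (k, 1)).card = 1 ∧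
        (colourClass p c γ (k, 1) \ colourClass p c γ (k, 0)).card = 0)) :
    1 ≤ (Finset.univ.filter fun x => c x = γ ∧ IsBound p c k x).card := by
  rw [Nat.one_le_iff_ne_zero, ← Nat.pos_iff_ne_zero, Finset.card_pos]
  rcases h with h | ⟨h, h'⟩
  · obtain ⟨x, hx⟩ := Finset.card_eq_one.1 h
    have hx' : x ∈ colourClass p c γ (k, 0) := by simp [hx]
    rw [mem_colourClass] at hx'
    refine ⟨x, ?_⟩
    simp only [Finset.mem_filter, Finset.mem_univ, true_and]
    exact ⟨hx'.1, hx'.2, Or.inl (by rw [hx'.1, hx])⟩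
  · rw [Finset.card_eq_zero, Finset.sdiff_eq_empty_iff_subset] at h'
    rw [Finset.inter_eq_right.2 h'] at h
    obtain ⟨x, hx⟩ := Finset.card_eq_one.1 h
    have hx' : x ∈ colourClass p c γ (k, 0) := h' (by simp [hx])
    rw [mem_colourClass] at hx'
    refine ⟨x, ?_⟩
    simp only [Finset.mem_filter, Finset.mem_univ, true_and]
    exact ⟨hx'.1, hx'.2, Or.inr (by rw [hx'.1, hx])⟩

/-- In one colour, `a`, `s`, `o` count the paths through both innermost edges of a leg, only the
first, and only the second; `n` counts the bound paths, and `x`, `y` record whether the class of the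
first or second edge is empty. Primes refer to the other colour. After the end counts are
substituted, this is half of what `IsSep.leg_inequality` needs. -/
lemma leg_arithmetic {a s o a' s' o' n n' x x' y y' : ℕ}
    (h : (1 ≤ s ∧ 1 ≤ o') ∨ (1 ≤ s' ∧ 1 ≤ o))
    (hn : a + s = 1 ∨ (a = 1 ∧ o = 0) → 1 ≤ n) (hn' : a' + s' = 1 ∨ (a' = 1 ∧ o' = 0) → 1 ≤ n')
    (hx : a + s = 0 → 1 ≤ x) (hx' : a' + s' = 0 → 1 ≤ x')
    (hy : a + o = 0 → 1 ≤ y) (hy' : a' + o' = 0 → 1 ≤ y') :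
    8 ≤ 3 * (o + o') + (s + s') + (a + a') + (n + n') + 2 * (x + x') + (y + y') := by
  omega

/-- Whether no path of colour `γ` contains the edge `e`, as a number. -/
def emptyCount (p : κ → LegPath ι) (c : κ → Bool) (γ : Bool) (e : ι × ℕ) : ℕ :=
  if colourClass p c γ e = ∅ then 1 else 0

lemma IsSep.leg_inequality (hS : IsSep ℓ p c) (k : ι) (h2 : 2 ≤ ℓ k) :
    (4 + 6 * ℓ k : ℤ) ≤ ∑ x, boundWeight p c k x + 3 * ((∑ x, endCount k 1 (p x) : ℕ) : ℤ) +
      4 * (emptyCount p c true (k, 0) + emptyCount p c false (k, 0)) +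
      2 * (emptyCount p c true (k, 1) + emptyCount p c false (k, 1)) := by
  rw [sum_boundWeight]
  have h1 := hS.colourClass_add_le_endCount k (ℓ k - 2) 1 (by omega)
  have h2' := sum_endCount_succ_add_le p c k 0
  have a1 := card_eq_inter_add_sdiff (colourClass p c true (k, 0)) (colourClass p c true (k, 1))
  have a2 := card_eq_inter_add_sdiff (colourClass p c false (k, 0)) (colourClass p c false (k, 1))
  have a3 := card_eq_inter_add_sdiff (colourClass p c true (k, 1)) (colourClass p c true (k, 0))
  have a4 := card_eq_inter_add_sdiff (colourClass p c false (k, 1)) (colourClass p c false (k, 0))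
  rw [Finset.inter_comm] at a3 a4
  have n1 := one_le_card_isBound p c k true
  have n2 := one_le_card_isBound p c k false
  have e1 : ∀ γ d, (colourClass p c γ (k, d)).card = 0 → 1 ≤ emptyCount p c γ (k, d) := by
    intro γ d h
    rw [Finset.card_eq_zero] at h
    simp [emptyCount, h]
  have e10 := e1 true 0
  have e20 := e1 false 0
  have e11 := e1 true 1
  have e21 := e1 false 1
  obtain ⟨γ, hγ1, hγ2⟩ := hS.colourClass_sdiff (e := (k, 0)) (f := (k, 1))
    (by simp only; omega) (by simp only; omega) (by simp)
  have hsep : (1 ≤ (colourClass p c true (k, 0) \ colourClass p c true (k, 1)).card ∧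
      1 ≤ (colourClass p c false (k, 1) \ colourClass p c false (k, 0)).card) ∨
      (1 ≤ (colourClass p c false (k, 0) \ colourClass p c false (k, 1)).card ∧
      1 ≤ (colourClass p c true (k, 1) \ colourClass p c true (k, 0)).card) := by
    cases γ
    · exact Or.inr ⟨hγ1.card_pos, hγ2.card_pos⟩
    · exact Or.inl ⟨hγ1.card_pos, hγ2.card_pos⟩
  simp only [zero_add, Nat.reduceAdd] at h1 h2'
  rw [a1] at n1 e10
  rw [a2] at n2 e20
  rw [a3] at e11 h1
  rw [a4] at e21 h1
  have := leg_arithmetic hsep n1 n2 e10 e20 e11 e21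
  rw [a1, a2]
  push_cast
  zify [h2] at *
  omega

/-- A path with exactly one end vertex at the centre. -/
def EndsAtCentre (P : LegPath ι) : Prop := ¬ (P.1.2 = 0 ↔ P.2.2 = 0)

instance : DecidablePred (EndsAtCentre (ι := ι)) := fun _ => inferInstanceAs (Decidable (¬ _))

lemma covers_zero (P : LegPath ι) (k : ι) :
    covers P (k, 0) = xor (decide (k = P.1.1 ∧ P.1.2 ≠ 0)) (decide (k = P.2.1 ∧ P.2.2 ≠ 0)) := by
  simp [covers, Nat.pos_iff_ne_zero]

lemma boundWeight_le_one (p : κ → LegPath ι) (c : κ → Bool) (k : ι) (x : κ) :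
    boundWeight p c k x ≤ 1 := by
  unfold boundWeight
  split_ifs <;> norm_num

/-- A path bound on both legs would by itself form the class of its colour at two different edges.
-/
lemma IsSep.boundWeight_add_le (hS : IsSep ℓ p c) (h2 : ∀ i, 2 ≤ ℓ i) {i j : ι} (hij : i ≠ j)
    (x : κ) (hi : covers (p x) (i, 0) = true) (hj : covers (p x) (j, 0) = true) :
    boundWeight p c i x + boundWeight p c j x ≤ 0 := by
  have : ¬ (IsBound p c i x ∧ IsBound p c j x) := by
    rintro ⟨⟨-, h1⟩, -, h3⟩
    have hi2 := h2 i
    have hj2 := h2 j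
    obtain ⟨d, hd, h1⟩ : ∃ d, d < ℓ i ∧ colourClass p c (c x) (i, d) = {x} := by
      rcases h1 with h | h
      exacts [⟨0, by omega, h⟩, ⟨1, by omega, h⟩]
    obtain ⟨d', hd', h3⟩ : ∃ d, d < ℓ j ∧ colourClass p c (c x) (j, d) = {x} := by
      rcases h3 with h | h
      exacts [⟨0, by omega, h⟩, ⟨1, by omega, h⟩]
    exact hS.colourClass_ne (e := (i, d)) (f := (j, d')) hd hd'
      (fun h => hij (congrArg Prod.fst h)) (c x) (h1.trans h3.symm)
  unfold boundWeight
  rw [if_pos hi, if_pos hj]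
  by_cases h1 : IsBound p c i x
  · rw [if_pos h1, if_neg fun h3 => this ⟨h1, h3⟩]
    norm_num
  · rw [if_neg h1]
    split_ifs <;> norm_num

/-- Two ends off the centre contribute 6, and the weights then total at most 0: they cancel or are
negative on two legs, and vanish when both ends lie on one leg. With exactly one end at the centre
the bound is `1 + 3 + 2`. -/
lemma IsSep.path_inequality [Fintype ι] (hS : IsSep ℓ p c) (h2 : ∀ i, 2 ≤ ℓ i) (x : κ) :
    ∑ k, boundWeight p c k x + 3 * ((∑ k, endCount k 1 (p x) : ℕ) : ℤ) +
      2 * (if EndsAtCentre (p x) then 1 else 0) ≤ 6 := by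
  rcases hP : p x with ⟨⟨i, a⟩, j, b⟩
  have hend : ∑ k, endCount k 1 ((i, a), (j, b)) =
      (if a = 0 then 0 else 1) + (if b = 0 then 0 else 1) := by
    unfold endCount
    rw [Finset.sum_add_distrib]
    congr 1
    · by_cases h : a = 0
      · simp [h]
      · simp [h, Nat.one_le_iff_ne_zero]
    · by_cases h : b = 0
      · simp [h]
      · simp [h, Nat.one_le_iff_ne_zero]
  rw [hend]
  have hcov := fun k => covers_zero (p x) k
  rw [hP] at hcov
  simp only at hcov
  have hw0 : ∀ k, covers (p x) (k, 0) = false → boundWeight p c k x = 0 := by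
    intro k hk
    simp [boundWeight, hk]
  rw [hP] at hw0
  simp only [EndsAtCentre]
  by_cases ha : a = 0 <;> by_cases hb : b = 0
  · rw [Finset.sum_eq_zero fun k _ => hw0 k (by rw [hcov]; simp [ha, hb])]
    simp [ha, hb]
  · rw [Finset.sum_eq_single j (fun k _ hk => hw0 k (by rw [hcov]; simp [ha, hk])) (by simp)]
    have := boundWeight_le_one p c j x
    simp only [ha, hb]
    norm_num
    linarith
  · rw [Finset.sum_eq_single i (fun k _ hk => hw0 k (by rw [hcov]; simp [hb, hk])) (by simp)]
    have := boundWeight_le_one p c i x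
    simp only [ha, hb]
    norm_num
    linarith
  · by_cases hij : i = j
    · subst hij
      rw [Finset.sum_eq_zero fun k _ => hw0 k (by rw [hcov]; simp [ha, hb])]
      simp [ha, hb]
    · have h0 : ∑ k, boundWeight p c k x = boundWeight p c i x + boundWeight p c j x := by
        rw [← Finset.sum_pair (f := fun k => boundWeight p c k x) hij]
        refine (Finset.sum_subset (Finset.subset_univ _) fun k _ hk => hw0 k ?_).symm
        simp only [Finset.mem_insert, Finset.mem_singleton, not_or] at hk
        simp [hcov, hk.1, hk.2]
      have := hS.boundWeight_add_le h2 hij x (by rw [hP]; simp [hcov, ha, hb, hij])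
        (by rw [hP]; simp [hcov, ha, hb, Ne.symm hij])
      rw [h0]
      simp only [ha, hb]
      norm_num
      linarith

lemma IsSep.sum_emptyCount_le [Fintype ι] (hS : IsSep ℓ p c) (h2 : ∀ i, 2 ≤ ℓ i) (γ : Bool) :
    ∑ k, (emptyCount p c γ (k, 0) + emptyCount p c γ (k, 1)) ≤ 1 := by
  have h : ∑ k, (emptyCount p c γ (k, 0) + emptyCount p c γ (k, 1)) =
      ((Finset.univ ×ˢ Finset.range 2).filter fun e : ι × ℕ => colourClass p c γ e = ∅).card := by
    rw [Finset.card_filter, Finset.sum_product]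
    refine Finset.sum_congr rfl fun k _ => ?_
    rw [Finset.sum_range_succ, Finset.sum_range_one]
    rfl
  rw [h, Finset.card_le_one]
  intro e he f hf
  simp only [Finset.mem_filter, Finset.mem_product, Finset.mem_univ, true_and,
    Finset.mem_range] at he hf
  by_contra hne
  exact hS.colourClass_ne (he.1.trans_le (h2 _)) (hf.1.trans_le (h2 _)) hne γ
    (he.2.trans hf.2.symm)

/-- The main counting inequality. -/
lemma IsSep.main_inequality [Fintype ι] (hS : IsSep ℓ p c) (h2 : ∀ i, 2 ≤ ℓ i) :
    4 * Fintype.card ι + 6 * ∑ k, ℓ k +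
      2 * (Finset.univ.filter fun x => EndsAtCentre (p x)).card ≤
    6 * Fintype.card κ +
      4 * (∑ k, emptyCount p c true (k, 0) + ∑ k, emptyCount p c false (k, 0)) +
      2 * (∑ k, emptyCount p c true (k, 1) + ∑ k, emptyCount p c false (k, 1)) := by
  have h1 := Finset.sum_le_sum fun k (_ : k ∈ Finset.univ) => hS.leg_inequality k (h2 k)
  have h3 := Finset.sum_le_sum fun x (_ : x ∈ Finset.univ) => hS.path_inequality h2 x
  simp only [Finset.sum_add_distrib, ← Finset.mul_sum, Finset.sum_const, Finset.card_univ,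
    nsmul_eq_mul, Nat.cast_sum] at h1 h3
  rw [Finset.sum_comm, Finset.sum_comm (s := Finset.univ (α := κ))
    (f := fun x k => ((endCount k 1 (p x) : ℕ) : ℤ))] at h3
  rw [Finset.card_filter]
  zify
  linarith

theorem IsSep.card_lower_bound [Fintype ι] (hS : IsSep ℓ p c) (h2 : ∀ i, 2 ≤ ℓ i) :
    2 * Fintype.card ι + 3 * ∑ k, ℓ k ≤ 3 * Fintype.card κ + 4 := by
  have h := hS.main_inequality h2
  have h1 := hS.sum_emptyCount_le h2 true
  have h3 := hS.sum_emptyCount_le h2 false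
  rw [Finset.sum_add_distrib] at h1 h3
  omega

/-- If colour `γ` avoided the innermost edge of leg `k`, each of its paths through the innermost
edge of one of the other two legs would have to continue into the third. Those two edges would then
have the same class. -/
lemma IsSep.colourClass_nonempty_of_card_eq_three [Fintype ι] (hS : IsSep ℓ p c)
    (h2 : ∀ i, 2 ≤ ℓ i) (hι : Fintype.card ι = 3) (γ : Bool)
    (hγ : ∀ x, c x = γ → ¬ EndsAtCentre (p x)) (k : ι) : colourClass p c γ (k, 0) ≠ ∅ := by
  intro hk
  have hcard : (Finset.univ.erase k).card = 2 := by
    rw [Finset.card_erase_of_mem (Finset.mem_univ k), Finset.card_univ, hι]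
  obtain ⟨i, j, hij, hset⟩ := Finset.card_eq_two.1 hcard
  have key : ∀ i j, i ≠ j → Finset.univ.erase k = {i, j} →
      colourClass p c γ (i, 0) ⊆ colourClass p c γ (j, 0) := by
    intro i j hij hset x hx
    rw [mem_colourClass] at hx ⊢
    refine ⟨hx.1, ?_⟩
    have hxk : covers (p x) (k, 0) ≠ true := by
      intro h
      have : x ∈ colourClass p c γ (k, 0) := mem_colourClass.2 ⟨hx.1, h⟩
      rw [hk] at this
      exact absurd this (Finset.notMem_empty x)
    have hall : ∀ l, l ≠ k → l ≠ i → l = j := by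
      intro l hlk hli
      have : l ∈ Finset.univ.erase k := by simp [hlk]
      rw [hset] at this
      simpa [hli] using this
    have hE := hγ x hx.1
    have hxi := hx.2
    rw [covers_zero] at hxi hxk ⊢
    rw [EndsAtCentre, not_not] at hE
    have hik : i ≠ k := by
      have : i ∈ Finset.univ.erase k := by simp [hset]
      exact (Finset.mem_erase.1 this).1
    have A := hall (p x).1.1
    have B := hall (p x).2.1
    grind
  exact hS.colourClass_ne (e := (i, 0)) (f := (j, 0)) (by have := h2 i; simp only; omega)
    (by have := h2 j; simp only; omega) (fun h => hij (congrArg Prod.fst h)) γ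
    (Finset.Subset.antisymm (key i j hij hset)
      (key j i hij.symm (by rw [hset, Finset.pair_comm])))

theorem IsSep.card_lower_bound_three [Fintype ι] (hS : IsSep ℓ p c) (h2 : ∀ i, 2 ≤ ℓ i)
    (hι : Fintype.card ι = 3) : ∑ k, ℓ k + 2 ≤ Fintype.card κ := by
  have h := hS.main_inequality h2
  have h1 := hS.sum_emptyCount_le h2 true
  have h3 := hS.sum_emptyCount_le h2 false
  rw [Finset.sum_add_distrib] at h1 h3
  have hzero : ∀ γ, (∀ x, c x = γ → ¬ EndsAtCentre (p x)) →
      ∑ k, emptyCount p c γ (k, 0) = 0 := by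
    intro γ hγ
    refine Finset.sum_eq_zero fun k _ => ?_
    simp [emptyCount, hS.colourClass_nonempty_of_card_eq_three h2 hι γ hγ k]
  by_contra hlt
  set C := Finset.univ.filter fun x => EndsAtCentre (p x) with hC
  -- With at most `∑ ℓ + 1` paths the main inequality leaves `6 + 2 * C.card` below the empty-class
  -- terms, which total at most 8. In the remaining cases some colour has no path ending at the
  -- centre, hence no empty class at an innermost edge, and the terms fall short.
  have hC1 : C.card ≤ 1 := by omega
  by_cases hC0 : C.card = 0
  · rw [Finset.card_eq_zero] at hC0
    have hno : ∀ x, ¬ EndsAtCentre (p x) := by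
      intro x hx
      have : x ∈ C := by simp [hC, hx]
      rw [hC0] at this
      exact absurd this (Finset.notMem_empty x)
    have t := hzero true fun x _ => hno x
    have f := hzero false fun x _ => hno x
    omega
  · obtain ⟨z, hz⟩ := Finset.card_eq_one.1 (show C.card = 1 by omega)
    have := hzero (!c z) (by
      intro x hx hE
      have hxC : x ∈ C := by simp [hC, hE]
      rw [hz, Finset.mem_singleton] at hxC
      subst hxC
      simp at hx)
    cases hcz : c z <;> rw [hcz] at this <;> simp only [Bool.not_true, Bool.not_false] at this <;>
      omega

end Lower

/-! ### Edges of a path as cuts. -/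

section Cut

variable {V : Type*} {G : SimpleGraph V}

/-- A walk traverses a bridge an even number of times iff its ends are on the same side. -/
lemma even_count_edges_iff [DecidableEq V] {S : V → Bool} {e : Sym2 V}
    (h : ∀ a b, G.Adj a b → (s(a, b) = e ↔ S a ≠ S b)) {u v : V} (p : G.Walk u v) :
    Even (p.edges.count e) ↔ S u = S v := by
  induction p with
  | nil => simp
  | cons hadj p ih =>
    rename_i u v w
    rw [SimpleGraph.Walk.edges_cons, List.count_cons]
    have := h u v hadj
    by_cases he : s(u, v) = e
    · have hS := this.1 he
      simp only [he, beq_self_eq_true, if_true, Nat.even_add_one, ih]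
      cases hu : S u <;> cases hv : S v <;> cases hw : S w <;> simp_all
    · have hS : S u = S v := by
        by_contra hS
        exact he (this.2 hS)
      simp [he, ih, hS]

lemma mem_edges_iff_of_isTrail {S : V → Bool} {e : Sym2 V}
    (h : ∀ a b, G.Adj a b → (s(a, b) = e ↔ S a ≠ S b)) {u v : V} (p : G.Walk u v)
    (hp : p.IsTrail) : e ∈ p.edges ↔ S u ≠ S v := by
  classical
  rw [ne_eq, ← even_count_edges_iff h p]
  by_cases he : e ∈ p.edges
  · simp [he, List.count_eq_one_of_mem hp.edges_nodup he]
  · simp [he, List.count_eq_zero_of_not_mem he]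

end Cut

/-! ### Translation between spiders and coded paths. -/

section Spider

variable {q : ℕ} {ℓ : Fin q → ℕ}

/-- The vertex of a spider on leg `i` at distance `a` from the centre (the centre if there is no
such vertex). -/
def spiderVertex (ℓ : Fin q → ℕ) (v : Fin q × ℕ) : Option (Σ i : Fin q, Fin (ℓ i)) :=
  if h : v.2 - 1 < ℓ v.1 ∧ v.2 ≠ 0 then some ⟨v.1, ⟨v.2 - 1, h.1⟩⟩ else none

/-- The leg and depth of a vertex of a spider; the centre is put on leg `i₀`. -/
def legDepth (i₀ : Fin q) : Option (Σ i : Fin q, Fin (ℓ i)) → Fin q × ℕ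
  | none => (i₀, 0)
  | some b => (b.1, b.2.val + 1)

/-- Whether a vertex is separated from the centre by the edge `e`. -/
def beyond (e : Fin q × ℕ) : Option (Σ i : Fin q, Fin (ℓ i)) → Bool
  | none => false
  | some b => decide (e.1 = b.1 ∧ e.2 ≤ b.2.val)

/-- The edge of leg `e.1` between distances `e.2` and `e.2 + 1` from the centre. -/
def spiderEdge (ℓ : Fin q → ℕ) (e : Fin q × ℕ) : Sym2 (Option (Σ i : Fin q, Fin (ℓ i))) :=
  s(spiderVertex ℓ e, spiderVertex ℓ (e.1, e.2 + 1))

lemma beyond_eq (i₀ : Fin q) (e : Fin q × ℕ) (w : Option (Σ i : Fin q, Fin (ℓ i))) :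
    beyond e w = decide (e.1 = (legDepth i₀ w).1 ∧ e.2 < (legDepth i₀ w).2) := by
  cases w <;> simp [beyond, legDepth]

lemma beyond_spiderVertex (e v : Fin q × ℕ) (hv : v.2 ≤ ℓ v.1) :
    beyond e (spiderVertex ℓ v) = decide (e.1 = v.1 ∧ e.2 < v.2) := by
  unfold spiderVertex
  split_ifs with h
  · simp only [beyond]
    congr 2
    simp only [eq_iff_iff]
    omega
  · have : v.2 = 0 := by omega
    simp [beyond, this]

lemma legDepth_le (i₀ : Fin q) (w : Option (Σ i : Fin q, Fin (ℓ i))) :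
    (legDepth i₀ w).2 ≤ ℓ (legDepth i₀ w).1 := by
  cases w with
  | none => exact Nat.zero_le _
  | some b => exact b.2.isLt

lemma spiderVertex_succ (i : Fin q) (d : ℕ) (hd : d < ℓ i) :
    spiderVertex ℓ (i, d + 1) = some ⟨i, ⟨d, hd⟩⟩ := by
  simp [spiderVertex, hd]

lemma spider_adj_spiderVertex (e : Fin q × ℕ) (he : e.2 < ℓ e.1) :
    (spider ℓ).Adj (spiderVertex ℓ e) (spiderVertex ℓ (e.1, e.2 + 1)) := by
  obtain ⟨i, d⟩ := e
  rw [spiderVertex_succ i d he, spider, SimpleGraph.fromRel_adj]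
  cases d with
  | zero => simp [spiderVertex]
  | succ d =>
    rw [spiderVertex_succ i d (Nat.lt_of_succ_lt he)]
    simp

lemma spiderEdge_mem_edgeSet (e : Fin q × ℕ) (he : e.2 < ℓ e.1) :
    spiderEdge ℓ e ∈ (spider ℓ).edgeSet := spider_adj_spiderVertex e he

/-- The defining relation of the spider holds exactly for the pairs parent and child. -/
lemma exists_eq_spiderVertex_of_adj {a b : Option (Σ i : Fin q, Fin (ℓ i))}
    (h : (spider ℓ).Adj a b) : ∃ e : Fin q × ℕ, e.2 < ℓ e.1 ∧
      ((a = spiderVertex ℓ e ∧ b = spiderVertex ℓ (e.1, e.2 + 1)) ∨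
        (b = spiderVertex ℓ e ∧ a = spiderVertex ℓ (e.1, e.2 + 1))) := by
  have key : ∀ a b : Option (Σ i : Fin q, Fin (ℓ i)), (match a, b with
      | none, some b => b.2.val = 0
      | some a, some b => a.1 = b.1 ∧ a.2.val + 1 = b.2.val
      | _, none => False) → ∃ e : Fin q × ℕ, e.2 < ℓ e.1 ∧
        a = spiderVertex ℓ e ∧ b = spiderVertex ℓ (e.1, e.2 + 1) := by
    rintro (_ | ⟨i, d, hd⟩) (_ | ⟨j, d', hd'⟩) h
    · exact h.elim
    · simp only at h
      subst h
      exact ⟨(j, 0), hd', by simp [spiderVertex], (spiderVertex_succ j 0 hd').symm⟩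
    · exact h.elim
    · obtain ⟨h1, h2⟩ := h
      simp only at h1 h2
      subst h1 h2
      exact ⟨(i, d + 1), hd', (spiderVertex_succ i d hd).symm,
        (spiderVertex_succ i (d + 1) hd').symm⟩
  rw [spider, SimpleGraph.fromRel_adj] at h
  rcases h.2 with h | h
  · obtain ⟨e, he, h1, h2⟩ := key a b h
    exact ⟨e, he, Or.inl ⟨h1, h2⟩⟩
  · obtain ⟨e, he, h1, h2⟩ := key b a h
    exact ⟨e, he, Or.inr ⟨h1, h2⟩⟩

lemma exists_eq_spiderEdge {e : Sym2 (Option (Σ i : Fin q, Fin (ℓ i)))}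
    (he : e ∈ (spider ℓ).edgeSet) : ∃ f : Fin q × ℕ, f.2 < ℓ f.1 ∧ e = spiderEdge ℓ f := by
  induction e with
  | _ a b =>
    obtain ⟨f, hf, ⟨rfl, rfl⟩ | ⟨rfl, rfl⟩⟩ :=
      exists_eq_spiderVertex_of_adj ((spider ℓ).mem_edgeSet.1 he)
    · exact ⟨f, hf, rfl⟩
    · exact ⟨f, hf, Sym2.eq_swap⟩

lemma beyond_ne_beyond_iff (e f : Fin q × ℕ) (hf : f.2 < ℓ f.1) :
    beyond e (spiderVertex ℓ f) ≠ beyond e (spiderVertex ℓ (f.1, f.2 + 1)) ↔ f = e := by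
  rw [beyond_spiderVertex _ _ hf.le, beyond_spiderVertex _ _ hf, ne_eq, decide_eq_decide]
  constructor
  · intro h
    have h1 : e.1 = f.1 := by
      by_contra h1
      exact h (by simp [h1])
    refine Prod.ext h1.symm ?_
    simp only [h1, true_and] at h
    omega
  · rintro rfl
    simp

lemma spiderEdge_injective {e f : Fin q × ℕ} (he : e.2 < ℓ e.1) (hf : f.2 < ℓ f.1)
    (h : spiderEdge ℓ e = spiderEdge ℓ f) : e = f := by
  have h1 := (beyond_ne_beyond_iff f f hf).2 rfl
  refine (beyond_ne_beyond_iff f e he).1 ?_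
  rw [spiderEdge, spiderEdge, Sym2.eq_iff] at h
  rcases h with ⟨h2, h3⟩ | ⟨h2, h3⟩
  · rwa [h2, h3]
  · rw [h2, h3]; exact h1.symm

lemma spiderEdge_eq_iff (e : Fin q × ℕ) (he : e.2 < ℓ e.1)
    (a b : Option (Σ i : Fin q, Fin (ℓ i))) (hab : (spider ℓ).Adj a b) :
    s(a, b) = spiderEdge ℓ e ↔ beyond e a ≠ beyond e b := by
  obtain ⟨f, hf, ⟨rfl, rfl⟩ | ⟨rfl, rfl⟩⟩ := exists_eq_spiderVertex_of_adj hab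
  · rw [beyond_ne_beyond_iff e f hf]
    exact ⟨fun h => spiderEdge_injective hf he h, fun h => by rw [h]; rfl⟩
  · rw [ne_comm, beyond_ne_beyond_iff e f hf, Sym2.eq_swap]
    exact ⟨fun h => spiderEdge_injective hf he h, fun h => by rw [h]; rfl⟩

lemma spiderEdge_mem_toSubgraph_iff (e : Fin q × ℕ) (he : e.2 < ℓ e.1)
    {u v : Option (Σ i : Fin q, Fin (ℓ i))} (p : (spider ℓ).Walk u v) (hp : p.IsPath) :
    spiderEdge ℓ e ∈ p.toSubgraph.edgeSet ↔ xor (beyond e u) (beyond e v) = true := by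
  rw [SimpleGraph.Walk.mem_edges_toSubgraph,
    mem_edges_iff_of_isTrail (spiderEdge_eq_iff e he) p hp.isTrail]
  cases beyond e u <;> cases beyond e v <;> simp

lemma spider_reachable_spiderVertex (i : Fin q) (d : ℕ) (hd : d ≤ ℓ i) :
    (spider ℓ).Reachable none (spiderVertex ℓ (i, d)) := by
  induction d with
  | zero => simp [spiderVertex]
  | succ d ih => exact (ih (by omega)).trans (spider_adj_spiderVertex (i, d) hd).reachable

/-- The coloured multiset is listed and indexed by position, so that repeated paths keep their
multiplicity. The leg `i₀` assigned to the centre is immaterial, since an end at depth 0 lies beyond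
no edge. -/
lemma HasSep.of_isRSPS {P : Multiset (spider ℓ).Subgraph} (i₀ : Fin q)
    (h : IsRSPS (spider ℓ) 2 P) : HasSep ℓ (Multiset.card P) := by
  obtain ⟨hP, C, hC, hsep⟩ := h
  obtain ⟨L, rfl⟩ := Quot.exists_rep C
  change Multiset.map Prod.fst (↑L : Multiset ((spider ℓ).Subgraph × Fin 2)) = P at hC
  have hpath : ∀ x : Fin L.length, IsPathOf (spider ℓ) (L.get x).1 := fun x =>
    hP _ (hC ▸ Multiset.mem_map_of_mem _ (by simp))
  choose u v w hw1 hw2 using hpath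
  let p : Fin L.length → LegPath (Fin q) := fun x => (legDepth i₀ (u x), legDepth i₀ (v x))
  have hcov : ∀ x e, e.2 < ℓ e.1 →
      (covers (p x) e = true ↔ spiderEdge ℓ e ∈ (L.get x).1.edgeSet) := by
    intro x e he
    rw [← hw2 x, spiderEdge_mem_toSubgraph_iff e he _ (hw1 x), beyond_eq i₀, beyond_eq i₀]
    rfl
  refine ⟨Fin L.length, inferInstance, p, fun x => decide ((L.get x).2 = 0),
    ⟨fun x => ⟨legDepth_le i₀ _, legDepth_le i₀ _⟩, fun e f he hf hne => ?_⟩, ?_⟩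
  · obtain ⟨X, hX, Y, hY, hXY, h1, h2⟩ := hsep _ (spiderEdge_mem_edgeSet e he) _
      (spiderEdge_mem_edgeSet f hf) fun h => hne (spiderEdge_injective he hf h)
    obtain ⟨x, rfl⟩ := List.get_of_mem (show X ∈ L from hX)
    obtain ⟨y, rfl⟩ := List.get_of_mem (show Y ∈ L from hY)
    refine ⟨x, y, ?_, ⟨(hcov x e he).2 h1.1, ?_⟩, (hcov y f hf).2 h2.1, ?_⟩
    · rw [ne_eq, decide_eq_decide]
      omega
    · rw [← Bool.not_eq_true, hcov x f hf]; exact h1.2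
    · rw [← Bool.not_eq_true, hcov y e he]; exact h2.2
  · rw [← hC]
    simp

lemma HasSep.exists_isRSPS {M : ℕ} (h : HasSep ℓ M) :
    ∃ P : Multiset (spider ℓ).Subgraph, IsRSPS (spider ℓ) 2 P ∧ Multiset.card P = M := by
  obtain ⟨κ, _, p, c, hS, hM⟩ := h
  have hreach : ∀ x, (spider ℓ).Reachable (spiderVertex ℓ (p x).1) (spiderVertex ℓ (p x).2) :=
    fun x => (spider_reachable_spiderVertex _ _ (hS.valid x).1).symm.trans
      (spider_reachable_spiderVertex _ _ (hS.valid x).2)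
  choose w hw using fun x => (hreach x).exists_isPath
  have hcov : ∀ x e, e.2 < ℓ e.1 →
      (spiderEdge ℓ e ∈ (w x).toSubgraph.edgeSet ↔ covers (p x) e = true) := by
    intro x e he
    rw [spiderEdge_mem_toSubgraph_iff e he _ (hw x), beyond_spiderVertex _ _ (hS.valid x).1,
      beyond_spiderVertex _ _ (hS.valid x).2]
    rfl
  let C : Multiset ((spider ℓ).Subgraph × Fin 2) :=
    Finset.univ.val.map fun x => ((w x).toSubgraph, if c x = true then 1 else 0)
  refine ⟨C.map Prod.fst, ⟨?_, C, rfl, ?_⟩, ?_⟩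
  · intro H hH
    simp only [C, Multiset.map_map, Multiset.mem_map, Function.comp] at hH
    obtain ⟨x, -, rfl⟩ := hH
    exact ⟨_, _, w x, hw x, rfl⟩
  · intro e he f hf hne
    obtain ⟨e, he', rfl⟩ := exists_eq_spiderEdge he
    obtain ⟨f, hf', rfl⟩ := exists_eq_spiderEdge hf
    obtain ⟨x, y, hxy, h1, h2⟩ := hS.sep e f he' hf' fun h => hne (by rw [h])
    refine ⟨_, Multiset.mem_map_of_mem _ (Finset.mem_univ_val x), _,
      Multiset.mem_map_of_mem _ (Finset.mem_univ_val y), ?_, ?_⟩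
    · cases hx : c x <;> cases hy : c y <;> simp_all
    · rw [hcov _ _ he', hcov _ _ hf', hcov _ _ he', hcov _ _ hf', h1.1, h1.2, h2.1, h2.2]
      simp
  · simp [C, ← hM, Finset.card_univ]

end Spider

/-! ### Invariance under graph isomorphism. -/

section Iso

variable {V W : Type*} {G : SimpleGraph V} {G' : SimpleGraph W}

lemma mem_edgeSet_map_iso (φ : G ≃g G') (H : G.Subgraph) (e : Sym2 V) :
    Sym2.map φ e ∈ (H.map φ.toHom).edgeSet ↔ e ∈ H.edgeSet := by
  rw [SimpleGraph.Subgraph.edgeSet_map]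
  exact (Sym2.map.injective φ.injective).mem_set_image

lemma IsRSPS.map_iso {k : ℕ} {P : Multiset G.Subgraph} (h : IsRSPS G k P) (φ : G ≃g G') :
    IsRSPS G' k (P.map (SimpleGraph.Subgraph.map φ.toHom)) := by
  obtain ⟨hP, C, hC, hsep⟩ := h
  refine ⟨?_, C.map (Prod.map (SimpleGraph.Subgraph.map φ.toHom) id), ?_, ?_⟩
  · intro H hH
    obtain ⟨H, hH', rfl⟩ := Multiset.mem_map.1 hH
    obtain ⟨u, v, p, hp, rfl⟩ := hP H hH'
    exact ⟨_, _, p.map φ.toHom, hp.map φ.injective,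
      SimpleGraph.Walk.toSubgraph_map _ _⟩
  · rw [← hC, Multiset.map_map, Multiset.map_map]
    rfl
  · have hpre : ∀ e ∈ G'.edgeSet, ∃ f ∈ G.edgeSet, Sym2.map φ f = e := by
      intro e he
      induction e with
      | _ a b =>
        refine ⟨s(φ.symm a, φ.symm b), ?_, by simp⟩
        exact φ.symm.map_adj_iff.2 he
    intro e he f hf hne
    obtain ⟨e, he', rfl⟩ := hpre e he
    obtain ⟨f, hf', rfl⟩ := hpre f hf
    obtain ⟨X, hX, Y, hY, hXY, h1, h2⟩ := hsep e he' f hf' fun h => hne (by rw [h])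
    refine ⟨_, Multiset.mem_map_of_mem _ hX, _, Multiset.mem_map_of_mem _ hY, hXY, ?_⟩
    simp only [Prod.map_fst, mem_edgeSet_map_iso]
    exact ⟨h1, h2⟩

lemma rainbowSepNumber_congr (φ : G ≃g G') (k : ℕ) :
    rainbowSepNumber G k = rainbowSepNumber G' k := by
  unfold rainbowSepNumber
  congr 1
  ext m
  constructor
  · rintro ⟨P, hP, hm⟩
    exact ⟨_, hP.map_iso φ, by rw [Multiset.card_map, hm]⟩
  · rintro ⟨P, hP, hm⟩
    exact ⟨_, hP.map_iso φ.symm, by rw [Multiset.card_map, hm]⟩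

end Iso

lemma rainbowSepNumber_spider {q : ℕ} (hq : 0 < q) (ℓ : Fin q → ℕ) :
    rainbowSepNumber (spider ℓ) 2 = sInf {m | HasSep ℓ m} := by
  unfold rainbowSepNumber
  congr 1
  ext m
  constructor
  · rintro ⟨P, hP, rfl⟩
    exact HasSep.of_isRSPS ⟨0, hq⟩ hP
  · exact HasSep.exists_isRSPS

lemma HasSep.lower_bound {q : ℕ} {ℓ : Fin q → ℕ} (h2 : ∀ i, 2 ≤ ℓ i) {M : ℕ}
    (h : HasSep ℓ M) : 2 * q + 3 * ∑ i, ℓ i ≤ 3 * M + 4 ∧ (q = 3 → ∑ i, ℓ i + 2 ≤ M) := by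
  classical
  obtain ⟨κ, _, p, c, hS, rfl⟩ := h
  refine ⟨?_, fun hq => hS.card_lower_bound_three h2 (by simpa using hq)⟩
  simpa using hS.card_lower_bound h2

end RainbowSep

theorem mainTheorem9 {V : Type*} [Fintype V] (G : SimpleGraph V) (n q : ℕ) (ℓ : Fin q → ℕ)
    (hq : 3 ≤ q) (hℓ : ∀ i, 2 ≤ ℓ i)
    (hG : Nonempty (G ≃g RainbowSep.spider ℓ)) (hn : Fintype.card V = n) :
    ((q = 3 ∨ 2 ≤ (Finset.univ.filter fun i => ℓ i = 2).card) →
      ((q = 3 ∨ q % 3 = 1) → RainbowSep.rainbowSepNumber G 2 = n - 1 + 2 * q / 3) ∧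
      (¬ (q = 3 ∨ q % 3 = 1) → RainbowSep.rainbowSepNumber G 2 = n - 2 + 2 * q / 3)) ∧
    ((3 < q ∧ (Finset.univ.filter fun i => ℓ i = 2).card ≤ 1) →
      (q % 3 = 1 → RainbowSep.rainbowSepNumber G 2 = n - 1 + 2 * q / 3) ∧
      (¬ q % 3 = 1 → ∃ ε : ℕ, (ε = 0 ∨ ε = 1) ∧
        RainbowSep.rainbowSepNumber G 2 = n - 2 + 2 * q / 3 + ε)) := by
  obtain ⟨φ⟩ := hG
  have hcard : n = ∑ i, ℓ i + 1 := by
    rw [← hn, Fintype.card_congr φ.toEquiv, Fintype.card_option, Fintype.card_sigma]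
    simp
  have hpos : 2 * q ≤ ∑ i, ℓ i := by
    have := Finset.sum_le_sum (fun i (_ : i ∈ Finset.univ) => hℓ i)
    simpa [mul_comm] using this
  rw [RainbowSep.rainbowSepNumber_congr φ, RainbowSep.rainbowSepNumber_spider (by omega)]
  set m := sInf {m | RainbowSep.HasSep ℓ m} with hm
  have upper : ∀ M, RainbowSep.HasSep ℓ M → m ≤ M := fun M h => Nat.sInf_le h
  have lower : ∀ M, RainbowSep.HasSep ℓ M →
      2 * q + 3 * ∑ i, ℓ i ≤ 3 * m + 4 ∧ (q = 3 → ∑ i, ℓ i + 2 ≤ m) := by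
    intro M h
    -- A known system is needed here: the infimum of an empty set of naturals would be 0 and need
    -- not be attained.
    have hmem : RainbowSep.HasSep ℓ m := Nat.sInf_mem (s := {m | RainbowSep.HasSep ℓ m}) ⟨M, h⟩
    exact hmem.lower_bound hℓ
  clear_value m
  have short : 2 ≤ (Finset.univ.filter fun i => ℓ i = 2).card →
      ∃ i j, i ≠ j ∧ ℓ i = 2 ∧ ℓ j = 2 := by
    intro h
    obtain ⟨i, hi, j, hj, hij⟩ := Finset.one_lt_card.1 h
    simp only [Finset.mem_filter, Finset.mem_univ, true_and] at hi hj
    exact ⟨i, j, hij, hi, hj⟩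
  have hmod : q % 3 = 0 ∨ q % 3 = 1 ∨ q % 3 = 2 := by omega
  rcases hmod with h3 | h3 | h3
  · have H : RainbowSep.HasSep ℓ (∑ i, ℓ i + 2 * (q / 3)) := by
      obtain ⟨t, rfl⟩ : ∃ t, q = 3 * t := ⟨q / 3, by omega⟩
      obtain ⟨κ, hκ, p, c, hS, hc, -⟩ := RainbowSep.hasBicolouredSep_three_mul t ℓ hℓ
      exact ⟨κ, hκ, p, c, hS, by omega⟩
    have hu := upper _ H
    have hl := lower _ H
    refine ⟨fun h => ⟨fun h' => by omega, fun h' => ?_⟩, fun h => ⟨fun h' => by omega, fun _ => ?_⟩⟩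
    -- Here `q = 3` is excluded, so `q ≥ 6` and there are two legs of length two; the six-leg system
    -- saves one path.
    · obtain ⟨i, j, hij, hi, hj⟩ := short (by omega)
      have hu' := upper _ (RainbowSep.hasSep_six_add_of_short (t := q / 3 - 2) (by omega) ℓ hℓ
        hij hi hj)
      omega
    · exact ⟨m - (n - 2 + 2 * q / 3), by omega, by omega⟩
  · have H := RainbowSep.hasSep_four_add (t := q / 3 - 1) (by omega) ℓ hℓ
    have hu := upper _ H
    have hl := lower _ H
    refine ⟨fun h => ⟨fun h' => by omega, fun h' => by omega⟩,
      fun h => ⟨fun h' => by omega, fun h' => by omega⟩⟩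
  · have H := RainbowSep.hasSep_five_add (t := q / 3 - 1) (by omega) ℓ hℓ
    have hu := upper _ H
    have hl := lower _ H
    refine ⟨fun h => ⟨fun h' => by omega, fun h' => ?_⟩, fun h => ⟨fun h' => by omega, fun _ => ?_⟩⟩
    · obtain ⟨i, j, hij, hi, hj⟩ := short (by omega)
      have hu' := upper _ (RainbowSep.hasSep_five_add_of_short (t := q / 3 - 1) (by omega) ℓ hℓ
        hij hi hj)
      omega
    · exact ⟨m - (n - 2 + 2 * q / 3), by omega, by omega⟩
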